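/- Let $F$ be a finite field. For a linear code $C\subseteq F^n$ and $S\subseteq[n]=\{1,\dots,n\}$ let $C_S\subseteq F^S$ be the projection of $C$ onto the coordinates in $S$, and let $d(C)$ be the minimum Hamming distance of $C$ (with $d(C)=\infty$ if $|C|=1$). For integers $1\le r\le k$ and $\delta\ge 2$, a *linear $(n,k,d,r,\delta)$-LRC* over $F$ is a linear code $C\subseteq F^n$ with $\dim C=k$ and $d(C)=d$ such that every $i\in[n]$ lies in some $S\subseteq [n]$ with $|S|\le r+\delta-1$ and $d(C_S)\ge\delta$. **Theorem.** Let $n,k,r,\delta$ be integers with $\delta\ge2$ and $$0<r<k\le n-\left\lceil \tfrac kr\right\rceil(\delta-1),$$ and put $a=\left\lceil \frac kr\right\rceil r-k$ and $b=\left\lceil\frac{n}{r+\delta-1}\right\rceil(r+\delta-1)-n$. Then there is a largest $d$ for which a linear $(n,k,d,r,\delta)$-LRC exists over some finite field; call it $d_{\max}$. Write $$B=n-k+1-\left(\left\lceil \tfrac kr\right\rceil-1\right)(\delta-1).$$ The following hold. (i) If $a\ge b$, then $d_{\max}=B$. (ii) If $b>a$, then $$d_{\max}\ge\begin{cases} n-k+1-\left\lceil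 \frac kr\right\rceil(\delta-1) & \text{if } b\le r-1,\\ n-k+1-\left\lceil \frac kr\right\rceil(\delta-1)+(b-r) & \text{if } b\ge r.\end{cases}$$ (iii) If $b>a$, $\left\lfloor \left\lceil \frac kr\right\rceil/2\right\rfloor\le a<\left\lceil \frac kr\right\rceil-1$ and $$\left\lceil\tfrac{n}{r+\delta-1}\right\rceil\ge\left\lceil \tfrac kr\right\rceil-1+(b-a)\left(1+\tfrac1t\right),\qquad\text{where } t=\left\lfloor \frac{a}{\lceil k/r\rceil-1-a}\right\rfloor,$$ then $d_{\max}=B$. (iv) If $b>a\ge\left\lceil \frac kr\right\rceil-1$, $\left\lceil \frac kr\right\rceil\ge3$ and $$\left\lceil\tfrac{n}{r+\delta-1}\right\rceil\ge\left\lfloor\tfrac{b}{stu}\right\rfloor\bigl(t(u-1)+2\bigr)+y,$$ where $s=\left\lfloor\frac{a}{\lceil k/r\rceil-1}\right\rfloor$, $t=\left\lfloor\frac{r-1}{s}\right\rfloor$, $u=\left\lceil\frac{\lceil k/r\rceil+1}{2}\right\rceil$, $x=\left\lceil\frac{b-\lfloor b/(stu)\rfloor stu}{s}\right\rceil$ and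 $$y=\begin{cases}0&\text{if } stu\mid b,\\ x-\left\lfloor\frac xu\right\rfloor+1+\min\left\{\left\lfloor\frac xu\right\rfloor,1\right\}&\text{if } stu\nmid b,\end{cases}$$ then $d_{\max}=B$. (v) If $b>a\ge\left\lceil \frac kr\right\rceil-1$, $\left\lceil \frac kr\right\rceil=2$ and either $2a\le r-1$ and $$\left\lceil\tfrac{n}{r+\delta-1}\right\rceil\ge\left\lceil\tfrac ba\right\rceil+1,$$ or $2a>r-1$, $\left\lfloor\frac{r-1}2\right\rfloor>0$ and $$\left\lceil\tfrac{n}{r+\delta-1}\right\rceil\ge\left\lceil\frac{b}{\lfloor (r-1)/2\rfloor}\right\rceil+1,$$ then $d_{\max}=B$. -/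

import Mathlib

namespace LRC

/-- The projection (puncturing) `C_S` of a code `C` of length indexed by `ι` onto the coordinates
in `S`. -/
def proj {ι A : Type*} (C : Set (ι → A)) (S : Finset ι) : Set (S → A) :=
  (fun (c : ι → A) (i : S) => c i) '' C

open Classical in
/-- The minimum Hamming distance of a code: the least Hamming distance between two distinct
codewords, with the value `⊤` if there are no two distinct codewords. -/
noncomputable def minDist {ι A : Type*} [Fintype ι] (C : Set (ι → A)) : ℕ∞ :=
  ⨅ u ∈ C, ⨅ v ∈ C, ⨅ _ : u ≠ v, (hammingDist u v : ℕ∞)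

/-- `S` is an `(r, δ)`-locality set of `C`: it has at most `r + δ - 1` elements and the projection
`C_S` has minimum distance at least `δ`. -/
def IsLocalitySet {ι A : Type*} (C : Set (ι → A)) (r δ : ℕ) (S : Finset ι) : Prop :=
  S.card ≤ r + δ - 1 ∧ (δ : ℕ∞) ≤ minDist (proj C S)

/-- A linear code `C` of length `n` over `F` is a linear `(n, k, d, r, δ)`-LRC: it has dimension
`k`, minimum distance `d`, and all-symbol locality `(r, δ)`, where `1 ≤ r ≤ k` and `2 ≤ δ`. -/
structure IsLinearLRC {F : Type*} [Field F] {n : ℕ} (C : Submodule F (Fin n → F))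
    (k d r δ : ℕ) : Prop where
  one_le_r : 1 ≤ r
  r_le_k : r ≤ k
  two_le_delta : 2 ≤ δ
  finrank_eq : Module.finrank F C = k
  minDist_eq : minDist (C : Set (Fin n → F)) = (d : ℕ∞)
  locality : ∀ i : Fin n, ∃ S : Finset (Fin n),
    i ∈ S ∧ IsLocalitySet (C : Set (Fin n → F)) r δ S

/-- The set of all `d` for which a linear `(n, k, d, r, δ)`-LRC exists over some finite field. -/
def achievable (n k r δ : ℕ) : Set ℕ :=
  {d | ∃ (F : Type) (_ : Field F) (_ : Finite F) (C : Submodule F (Fin n → F)),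
    IsLinearLRC C k d r δ}

/-- The largest `d` for which a linear `(n, k, d, r, δ)`-LRC exists over some finite field. -/
noncomputable def dMax (n k r δ : ℕ) : ℕ := sSup (achievable n k r δ)

end LRC

namespace LRC

/-! ### Minimum distance as minimum weight, and passage to subcodes. -/

section MinDist

variable {ι A : Type*} [Fintype ι]

/-! Upper bound (`IsLinearLRC.add_le`): force zeros on `⌈k/r⌉ - 1` locality sets in turn. Each costs
at most `r` dimensions and brings at least `δ - 1` more zeros than lost dimensions; the Singleton
bound for the remaining subcode gives `d ≤ B`.

Lower bounds: take the kernel of a matrix with `δ - 1` rows supported on each local set and further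
rows of full support, with generic entries. Columns are independent when the pattern has a
transversal on them. By Hall's theorem this holds for every small set of columns, provided any `K +
1` or more local sets, say `j` of them, cover at least `k + j(δ - 1)` coordinates
(`exists_achievable_of_cover`).

Let `M = ⌈n/(r + δ - 1)⌉` local sets of size `r + δ - 1` share coordinates along the `b` edges of a
multigraph, which makes the length `n`. The condition becomes: degrees are at most `r`, and any
`⌈k/r⌉` vertices span at most `a` edges (`exists_achievable_of_graph`). Each case of equality has
its graph: `b` parallel edges for (i), disjoint paths for (iii), theta graphs of girth above `⌈k/r⌉`
with repeated edges for (iv), a path with repeated edges for (v). In (ii) parallel edges serve with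
a weaker distance if `b < r`; otherwise one local set is dropped and a coordinate is repeated. -/

theorem le_minDist_iff [DecidableEq A] {C : Set (ι → A)} {D : ℕ} :
    (D : ℕ∞) ≤ minDist C ↔ ∀ u ∈ C, ∀ v ∈ C, u ≠ v → D ≤ hammingDist u v := by
  simp only [minDist, le_iInf_iff, Nat.cast_le]
  refine forall₅_congr fun u _ v _ _ => ?_
  rw [iff_iff_eq]
  congr!

theorem minDist_le [DecidableEq A] {C : Set (ι → A)} {u v : ι → A} (hu : u ∈ C) (hv : v ∈ C)
    (huv : u ≠ v) : minDist C ≤ hammingDist u v := by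
  have h : minDist C ≤ _ := iInf₂_le_of_le u hu (iInf₂_le_of_le v hv (iInf_le_of_le huv le_rfl))
  refine h.trans (le_of_eq ?_)
  congr!

theorem le_minDist_submodule_iff {F : Type*} [Field F] [DecidableEq F] {C : Submodule F (ι → F)}
    {D : ℕ} : (D : ℕ∞) ≤ minDist (C : Set (ι → F)) ↔ ∀ c ∈ C, c ≠ 0 → D ≤ hammingNorm c := by
  rw [le_minDist_iff]
  constructor
  · intro h c hc h0
    simpa using h c hc 0 C.zero_mem h0
  · intro h u hu v hv huv
    rw [hammingDist_eq_hammingNorm]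
    exact h _ (by simpa [neg_add_eq_sub] using C.sub_mem hv hu)
      (by simpa [neg_add_eq_sub, sub_eq_zero] using huv.symm)

theorem exists_minDist_eq {F : Type*} [Field F] {C : Submodule F (ι → F)} (hC : C ≠ ⊥) :
    ∃ d : ℕ, minDist (C : Set (ι → F)) = d := by
  classical
  obtain ⟨c, hc, h0⟩ := C.exists_mem_ne_zero_of_ne_bot hC
  have h := minDist_le (C := (C : Set (ι → F))) hc C.zero_mem h0
  exact ⟨_, (ENat.natCast_toNat (ne_top_of_le_ne_top (ENat.natCast_ne_top _) h)).symm⟩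

open Classical in
theorem le_minDist_proj_iff {ι F : Type*} [Field F] {C : Submodule F (ι → F)} {S : Finset ι}
    {D : ℕ} : (D : ℕ∞) ≤ minDist (proj (C : Set (ι → F)) S) ↔
      ∀ c ∈ C, (∃ i ∈ S, c i ≠ 0) → D ≤ (S.filter fun i => c i ≠ 0).card := by
  have key (c : ι → F) :
      hammingNorm (fun i : S => c i) = (S.filter fun i => c i ≠ 0).card := by
    rw [hammingNorm, ← Finset.card_map (Function.Embedding.subtype _)]
    congr 1
    ext i
    simp [and_comm]
  rw [le_minDist_iff]
  constructor
  · rintro h c hc ⟨i, hi, hci⟩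
    rw [← key]
    have := h (fun i : S => (0 : ι → F) i) ⟨0, C.zero_mem, rfl⟩ (fun i : S => c i) ⟨c, hc, rfl⟩
      (fun h => hci (congrFun h ⟨i, hi⟩).symm)
    rwa [hammingDist_eq_hammingNorm,
      show (fun i : S => (0 : ι → F) i) = 0 from rfl, neg_zero, zero_add] at this
  · rintro h _ ⟨u, hu, rfl⟩ _ ⟨v, hv, rfl⟩ huv
    obtain ⟨⟨i, hi⟩, hne⟩ := Function.ne_iff.1 huv
    have := h (v - u) (C.sub_mem hv hu) ⟨i, hi, by simpa [sub_eq_zero] using Ne.symm hne⟩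
    rw [hammingDist_eq_hammingNorm]
    rw [← key] at this
    rwa [neg_add_eq_sub]

/-- Passing to a subcode of the right dimension, one sees that only the locality and a lower bound
on the weights matter. -/
theorem exists_achievable {n k r δ D : ℕ} (hr : 1 ≤ r) (hrk : r ≤ k) (hδ : 2 ≤ δ) {F : Type}
    [Field F] [Finite F] [DecidableEq F] (C : Submodule F (Fin n → F))
    (hk : k ≤ Module.finrank F C) (hD : ∀ c ∈ C, c ≠ 0 → D ≤ hammingNorm c)
    (hloc : ∀ i : Fin n, ∃ S : Finset (Fin n), i ∈ S ∧ IsLocalitySet (C : Set (Fin n → F)) r δ S) :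
    ∃ d ∈ achievable n k r δ, D ≤ d := by
  obtain ⟨f, hf⟩ := exists_linearIndependent_of_le_finrank hk
  have hf' : LinearIndependent F (fun i => (f i : Fin n → F)) :=
    hf.map' C.subtype (Submodule.ker_subtype C)
  set C' : Submodule F (Fin n → F) := Submodule.span F (Set.range fun i => (f i : Fin n → F))
  have hle : C' ≤ C := Submodule.span_le.2 (by rintro _ ⟨i, rfl⟩; exact (f i).2)
  have hfin : Module.finrank F C' = k := by
    simpa using finrank_span_eq_card hf'
  have hbot : C' ≠ ⊥ := by
    intro h
    rw [h, finrank_bot] at hfin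
    omega
  obtain ⟨d, hd⟩ := exists_minDist_eq hbot
  refine ⟨d, ⟨F, _, ‹_›, C', hr, hrk, hδ, hfin, hd, fun i => ?_⟩, ?_⟩
  · obtain ⟨S, hiS, hS, hmin⟩ := hloc i
    refine ⟨S, hiS, hS, ?_⟩
    classical
    rw [le_minDist_proj_iff] at hmin ⊢
    exact fun c hc => hmin c (hle hc)
  · have : (D : ℕ∞) ≤ minDist (C' : Set (Fin n → F)) :=
      le_minDist_submodule_iff.2 fun c hc => hD c (hle hc)
    rw [hd] at this
    exact_mod_cast this

end MinDist

/-! ### Generic matrices with a prescribed zero pattern. -/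

section Generic

open MvPolynomial

variable {R ι : Type*} [DecidableEq R] [DecidableEq ι]

/-- The matrix with independent indeterminates at the positions of the pattern. -/
noncomputable def patternMatrix (supp : R → Finset ι) : Matrix R ι (MvPolynomial (R × ι) ℤ) :=
  fun ρ i => if i ∈ supp ρ then X (ρ, i) else 0

/-- Setting the indeterminates on the graph of `f` to 1 and all others to 0 turns the submatrix into
the identity. -/
theorem det_patternMatrix_ne_zero (supp : R → Finset ι) (T : Finset ι) (f : T → R)
    (hf : Function.Injective f) (hs : ∀ i, (i : ι) ∈ supp (f i)) :
    (Matrix.of fun i j : T => patternMatrix supp (f i) j).det ≠ 0 := by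
  intro h
  let x : R × ι → ℤ := fun q => if ∃ i : T, (i : ι) = q.2 ∧ f i = q.1 then 1 else 0
  have h1 := congrArg (eval x) h
  rw [RingHom.map_det, map_zero] at h1
  have : (eval x).mapMatrix (Matrix.of fun i j : T => patternMatrix supp (f i) j) = 1 := by
    ext i j
    rw [RingHom.mapMatrix_apply, Matrix.map_apply, Matrix.of_apply, patternMatrix,
      Matrix.one_apply]
    by_cases hij : i = j
    · subst hij
      rw [if_pos (hs i), if_pos rfl, eval_X]
      exact if_pos ⟨i, rfl, rfl⟩
    · rw [if_neg hij]
      split_ifs with hm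
      · rw [eval_X]
        refine if_neg ?_
        rintro ⟨l, hl, hfl⟩
        exact hij ((hf hfl).symm.trans (Subtype.ext hl))
      · simp
  rw [this, Matrix.det_one] at h1
  exact one_ne_zero h1

/-- Over some prime field there is a matrix with a prescribed pattern of zeros all of whose square
submatrices with a transversal in the pattern are nonsingular. -/
theorem exists_generic_matrix [Fintype R] [Fintype ι] (supp : R → Finset ι) :
    ∃ (p : ℕ) (_ : Fact p.Prime) (H : Matrix R ι (ZMod p)),
      (∀ ρ i, i ∉ supp ρ → H ρ i = 0) ∧
      ∀ (T : Finset ι) (f : T → R), Function.Injective f → (∀ i, (i : ι) ∈ supp (f i)) →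
        (Matrix.of fun i j : T => H (f i) j).det ≠ 0 := by
  classical
  let P : (Σ T : Finset ι, (T → R)) → MvPolynomial (R × ι) ℤ := fun q =>
    (Matrix.of fun i j : q.1 => patternMatrix supp (q.2 i) j).det
  -- The product of all nonzero determinants is a nonzero integer polynomial, so it is nonzero at
  -- some integer point; a prime exceeding its absolute value there keeps every factor nonzero
  -- modulo `p`.
  have hprod : ∏ q ∈ Finset.univ.filter (fun q => P q ≠ 0), P q ≠ 0 :=
    Finset.prod_ne_zero_iff.2 fun q hq => (Finset.mem_filter.1 hq).2
  obtain ⟨x, hx⟩ : ∃ x, eval x (∏ q ∈ Finset.univ.filter (fun q => P q ≠ 0), P q) ≠ 0 := by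
    by_contra! h
    exact hprod (MvPolynomial.funext fun x => by rw [h x, map_zero])
  set N := eval x (∏ q ∈ Finset.univ.filter (fun q => P q ≠ 0), P q) with hN
  obtain ⟨p, hpN, hp⟩ := Nat.exists_infinite_primes (N.natAbs + 1)
  have : Fact p.Prime := ⟨hp⟩
  have hNp : ((N : ℤ) : ZMod p) ≠ 0 := by
    rw [Ne, ZMod.intCast_zmod_eq_zero_iff_dvd]
    intro hdvd
    have := Nat.le_of_dvd (Int.natAbs_pos.2 hx) (Int.natCast_dvd.1 hdvd)
    omega
  let φ : MvPolynomial (R × ι) ℤ →+* ZMod p := (Int.castRingHom (ZMod p)).comp (eval x)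
  refine ⟨p, this, fun ρ i => φ (patternMatrix supp ρ i), fun ρ i hi => ?_, fun T f hf hs => ?_⟩
  · simp [patternMatrix, hi]
  · have hmem : (⟨T, f⟩ : Σ T : Finset ι, (T → R)) ∈ Finset.univ.filter (fun q => P q ≠ 0) :=
      Finset.mem_filter.2 ⟨Finset.mem_univ _, det_patternMatrix_ne_zero supp T f hf hs⟩
    have h1 : φ (∏ q ∈ Finset.univ.filter (fun q => P q ≠ 0), P q) ≠ 0 := hNp
    rw [map_prod, Finset.prod_ne_zero_iff] at h1
    have h2 := h1 _ hmem
    simp only [P] at h2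
    rw [RingHom.map_det] at h2
    exact h2

end Generic

/-! ### The generic code of a family of local sets. -/

section Construction

theorem eq_zero_of_det_ne_zero {R ι F : Type*} [DecidableEq ι] [Field F] (H : Matrix R ι F)
    (T : Finset ι) (f : T → R) (hdet : (Matrix.of fun i j : T => H (f i) j).det ≠ 0)
    (c : ι → F) (h : ∀ i, ∑ j ∈ T, H (f i) j * c j = 0) : ∀ j ∈ T, c j = 0 := by
  have h0 : (fun j : T => c j) = 0 := by
    refine Matrix.eq_zero_of_mulVec_eq_zero hdet (funext fun i => ?_)
    rw [Pi.zero_apply, ← h i, ← Finset.sum_coe_sort]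
    rfl
  exact fun j hj => congrFun h0 ⟨j, hj⟩

/-- A generic code with `δ - 1` parity checks on each of the sets `X_i = {q | i ∈ N q}`. -/
theorem exists_achievable_of_cover {n k r δ m K D : ℕ} (hr : 1 ≤ r) (hrk : r ≤ k) (hδ : 2 ≤ δ)
    (N : Fin n → Finset (Fin m)) (hcov : ∀ q, (N q).Nonempty)
    (hsize : ∀ i, (Finset.univ.filter fun q => i ∈ N q).card ≤ r + δ - 1)
    (hJ : ∀ J : Finset (Fin m), K + 1 ≤ J.card →
      k + J.card * (δ - 1) ≤ (Finset.univ.filter fun q => ∃ i ∈ J, i ∈ N q).card)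
    (hKm : K + 1 ≤ m) (hD : D + k + K * (δ - 1) ≤ n + 1) :
    ∃ d ∈ achievable n k r δ, D ≤ d := by
  have htot : k + m * (δ - 1) ≤ n := by
    have h1 := hJ Finset.univ (by simpa using hKm)
    have h2 := Finset.card_filter_le (Finset.univ : Finset (Fin n))
      (fun q => ∃ i ∈ (Finset.univ : Finset (Fin m)), i ∈ N q)
    simp only [Finset.card_univ, Fintype.card_fin] at h1 h2
    omega
  -- The `g` rows of full support bring the number of rows to `n - k`, so the kernel has dimension
  -- at least `k`.
  obtain ⟨g, hg⟩ := Nat.exists_eq_add_of_le htot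
  let R := (Fin m × Fin (δ - 1)) ⊕ Fin g
  let supp : R → Finset (Fin n) :=
    Sum.elim (fun x => Finset.univ.filter fun q => x.1 ∈ N q) (fun _ => Finset.univ)
  obtain ⟨p, _, H, hH0, hH⟩ := exists_generic_matrix supp
  have hker (c : Fin n → ZMod p) (hc : c ∈ LinearMap.ker H.mulVecLin) (ρ : R) (T : Finset (Fin n))
      (hT : ∀ q ∈ supp ρ, c q ≠ 0 → q ∈ T) : ∑ j ∈ T, H ρ j * c j = 0 := by
    have h1 : ∑ j, H ρ j * c j = 0 := congrFun hc ρ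
    rw [← h1]
    refine Finset.sum_subset (Finset.subset_univ _) fun j _ hj => ?_
    by_cases hs : j ∈ supp ρ
    · by_cases hcj : c j = 0
      · rw [hcj, mul_zero]
      · exact absurd (hT j hs hcj) hj
    · rw [hH0 ρ j hs, zero_mul]
  refine exists_achievable hr hrk hδ (LinearMap.ker H.mulVecLin) ?_ ?_ ?_
  · have h1 := LinearMap.finrank_range_add_finrank_ker H.mulVecLin
    have h2 : Module.finrank (ZMod p) (LinearMap.range H.mulVecLin) ≤ Fintype.card R :=
      (Submodule.finrank_le _).trans_eq (Module.finrank_fintype_fun_eq_card _)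
    rw [Module.finrank_fintype_fun_eq_card, Fintype.card_fin] at h1
    rw [Fintype.card_sum, Fintype.card_prod, Fintype.card_fin, Fintype.card_fin,
      Fintype.card_fin] at h2
    omega
  · intro c hc h0
    by_contra! hlt
    obtain ⟨q, hq⟩ := Function.ne_iff.1 h0
    set T : Finset (Fin n) := Finset.univ.filter fun q => c q ≠ 0 with hTdef
    have hTcard : T.card < D := hlt
    -- Hall's condition for matching the support of a light codeword into rows; a transversal makes
    -- those columns independent. A nonempty `s` meets the `δ - 1` rows of every local set in `I`
    -- and all `g` full rows.
    obtain ⟨f, hf, hfs⟩ := (Finset.all_card_le_biUnion_card_iff_exists_injective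
      (fun j : T => Finset.univ.filter fun ρ : R => (j : Fin n) ∈ supp ρ)).1 (by
        intro s
        rcases s.eq_empty_or_nonempty with rfl | ⟨j₀, hj₀⟩
        · simp
        let I : Finset (Fin m) := Finset.univ.filter fun i => ∃ j ∈ s, i ∈ N j
        have hsub : (I ×ˢ (Finset.univ : Finset (Fin (δ - 1)))).disjSum (Finset.univ : Finset (Fin g))
            ⊆ s.biUnion (fun j : T => Finset.univ.filter fun ρ : R => (j : Fin n) ∈ supp ρ) := by
          rintro (⟨i, l⟩ | l) hρ
          · simp only [Finset.inl_mem_disjSum, Finset.mem_product, I, Finset.mem_filter,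
              Finset.mem_univ, true_and, and_true] at hρ
            obtain ⟨j, hj, hij⟩ := hρ
            exact Finset.mem_biUnion.2 ⟨j, hj, by simp [supp, hij]⟩
          · exact Finset.mem_biUnion.2 ⟨j₀, hj₀, by simp [supp]⟩
        have h1 := Finset.card_le_card hsub
        rw [Finset.card_disjSum, Finset.card_product, Finset.card_univ, Finset.card_univ,
          Fintype.card_fin, Fintype.card_fin] at h1
        refine le_trans ?_ h1
        have hsT : s.card ≤ T.card := by simpa using Finset.card_le_univ s
        have hIc := Finset.card_add_card_compl I
        rw [Fintype.card_fin] at hIc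
        -- If more than `K` local sets miss `s`, then `s` avoids the many coordinates that they
        -- cover. Otherwise at least `(m - K)(δ - 1) + g` rows meet `s`, which is at least `D - 1`.
        by_cases hc : K + 1 ≤ Iᶜ.card
        · have h2 := hJ _ hc
          have h3 : (s.map (Function.Embedding.subtype _)).card +
              (Finset.univ.filter fun q => ∃ i ∈ Iᶜ, i ∈ N q).card ≤ n := by
            rw [← Finset.card_union_of_disjoint]
            · simpa using Finset.card_le_univ (s.map (Function.Embedding.subtype _) ∪
                (Finset.univ.filter fun q => ∃ i ∈ Iᶜ, i ∈ N q))
            · rw [Finset.disjoint_left]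
              intro q hq hq'
              obtain ⟨j, hj, rfl⟩ := Finset.mem_map.1 hq
              obtain ⟨i, hi, hij⟩ := (Finset.mem_filter.1 hq').2
              exact (Finset.mem_compl.1 hi) (Finset.mem_filter.2 ⟨Finset.mem_univ _, j, hj, hij⟩)
          rw [Finset.card_map] at h3
          have h4 : m * (δ - 1) = I.card * (δ - 1) + Iᶜ.card * (δ - 1) := by
            rw [← add_mul, hIc]
          omega
        · have h4 : m * (δ - 1) ≤ I.card * (δ - 1) + K * (δ - 1) := by
            rw [← add_mul]
            exact Nat.mul_le_mul_right _ (by omega)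
          omega)
    refine hq (eq_zero_of_det_ne_zero H T f
      (hH T f hf fun i => (Finset.mem_filter.1 (hfs i)).2) c (fun i => ?_) q ?_)
    · exact hker c hc _ _ fun q _ hq => by simpa [hTdef] using hq
    · simpa [hTdef] using hq
  · intro q
    obtain ⟨i, hi⟩ := hcov q
    refine ⟨Finset.univ.filter fun q => i ∈ N q, by simpa using hi, hsize i, ?_⟩
    classical
    rw [le_minDist_proj_iff]
    rintro c hc ⟨j, hj, hcj⟩
    by_contra! hlt
    set T : Finset (Fin n) := (Finset.univ.filter fun q => i ∈ N q).filter fun q => c q ≠ 0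
    have hTlt : T.card < δ := by convert! hlt
    -- Fewer than `δ` columns inside a local set find a transversal among its own `δ - 1` rows.
    obtain ⟨e⟩ : Nonempty (T ↪ Fin (δ - 1)) := by
      apply Function.Embedding.nonempty_of_card_le
      rw [Fintype.card_coe, Fintype.card_fin]
      omega
    refine hcj (eq_zero_of_det_ne_zero H T (fun q => Sum.inl (i, e q)) (hH T _ ?_ ?_) c
      (fun l => ?_) j (Finset.mem_filter.2 ⟨hj, hcj⟩))
    · intro x y hxy
      exact e.injective (Prod.ext_iff.1 (Sum.inl.inj hxy)).2
    · intro x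
      exact (Finset.mem_filter.1 x.2).1
    · exact hker c hc _ _ fun q hq hcq => Finset.mem_filter.2 ⟨hq, hcq⟩

end Construction

/-- The coordinates of a code may be repeated. -/
theorem exists_achievable_of_le_length {n n' k r δ d : ℕ} (hn' : 0 < n') (hnn : n' ≤ n)
    (hd : d ∈ achievable n' k r δ) : ∃ d' ∈ achievable n k r δ, d ≤ d' := by
  classical
  obtain ⟨F, _, _, C, hC⟩ := hd
  let φ : Fin n → Fin n' := fun i => ⟨min i (n' - 1), by omega⟩
  have hφ (j : Fin n') : φ (j.castLE hnn) = j := by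
    ext
    simp only [φ, Fin.val_castLE]
    omega
  let L : (Fin n' → F) →ₗ[F] (Fin n → F) := LinearMap.funLeft F F φ
  have hL : Function.Injective L :=
    LinearMap.funLeft_injective_of_surjective F F φ fun j => ⟨_, hφ j⟩
  refine exists_achievable hC.one_le_r hC.r_le_k hC.two_le_delta (C.map L) ?_ ?_ ?_
  · rw [← hC.finrank_eq]
    exact (Submodule.equivMapOfInjective L hL C).finrank_eq.le
  · rintro _ ⟨c, hc, rfl⟩ h0
    have hc0 : c ≠ 0 := by
      rintro rfl
      exact h0 (map_zero L)
    have h1 := le_minDist_submodule_iff.1 hC.minDist_eq.ge c hc hc0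
    refine h1.trans ?_
    rw [hammingNorm, hammingNorm, ← Finset.card_map (Fin.castLEEmb hnn)]
    refine Finset.card_le_card fun i hi => ?_
    obtain ⟨j, hj, rfl⟩ := Finset.mem_map.1 hi
    refine Finset.mem_filter.2 ⟨Finset.mem_univ _, ?_⟩
    change c (φ (j.castLE hnn)) ≠ 0
    rw [hφ]
    exact (Finset.mem_filter.1 hj).2
  · intro i
    obtain ⟨S, hiS, hS, hmin⟩ := hC.locality (φ i)
    -- A section of `φ` passing through `i`, so that the transported locality set contains `i`
    -- itself.
    let σ : Fin n' → Fin n := fun j => if j = φ i then i else j.castLE hnn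
    have hσ (j : Fin n') : φ (σ j) = j := by
      by_cases h : j = φ i
      · simp [σ, h]
      · simp [σ, h, hφ]
    refine ⟨S.image σ, Finset.mem_image.2 ⟨φ i, hiS, by simp [σ]⟩,
      Finset.card_image_le.trans hS, ?_⟩
    rw [le_minDist_proj_iff] at hmin ⊢
    rintro _ ⟨c, hc, rfl⟩ ⟨l, hl, hcl⟩
    obtain ⟨j, hj, rfl⟩ := Finset.mem_image.1 hl
    have hLσ (j : Fin n') : L c (σ j) = c j := by
      simp [L, LinearMap.funLeft_apply, hσ]
    rw [hLσ] at hcl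
    refine (hmin c hc ⟨j, hj, hcl⟩).trans ?_
    rw [Finset.filter_image, Finset.card_image_of_injective _
      (Function.LeftInverse.injective hσ)]
    simp only [hLσ, le_refl]

/-! ### The Singleton-type upper bound. -/

section Singleton

variable {ι F : Type*} [Field F]

/-- The space of words that vanish on `S`. -/
def vanishingOn (F : Type*) [Field F] (S : Finset ι) : Submodule F (ι → F) :=
  LinearMap.ker (LinearMap.funLeft F F (Subtype.val : S → ι))

theorem mem_vanishingOn {S : Finset ι} {c : ι → F} : c ∈ vanishingOn F S ↔ ∀ i ∈ S, c i = 0 := by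
  rw [vanishingOn, LinearMap.mem_ker, funext_iff]
  simp [LinearMap.funLeft_apply]

theorem finrank_le_finrank_inf_vanishingOn_add_card [Finite ι] (V : Submodule F (ι → F))
    (S : Finset ι) :
    Module.finrank F V ≤ Module.finrank F (V ⊓ vanishingOn F S : Submodule F (ι → F)) + S.card := by
  let φ : V →ₗ[F] (S → F) := (LinearMap.funLeft F F (Subtype.val : S → ι)).comp V.subtype
  have h1 := LinearMap.finrank_range_add_finrank_ker φ
  have h2 : Module.finrank F (LinearMap.range φ) ≤ S.card := by
    simpa using Submodule.finrank_le (LinearMap.range φ)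
  have h3 : Module.finrank F (LinearMap.ker φ) =
      Module.finrank F (V ⊓ vanishingOn F S : Submodule F (ι → F)) := by
    rw [← Submodule.map_comap_subtype]
    exact (Submodule.equivMapOfInjective _ V.injective_subtype _).finrank_eq
  omega

open Classical in
/-- The Singleton bound for the restriction of a code to `S`. -/
theorem finrank_add_le_of_le_weight [Finite ι] (V : Submodule F (ι → F)) (S : Finset ι) {D : ℕ}
    (hD : 1 ≤ D) (hV : ∃ c ∈ V, ∃ i ∈ S, c i ≠ 0)
    (hw : ∀ c ∈ V, (∃ i ∈ S, c i ≠ 0) → D ≤ (S.filter fun i => c i ≠ 0).card) :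
    Module.finrank F V + D ≤
      Module.finrank F (V ⊓ vanishingOn F S : Submodule F (ι → F)) + S.card + 1 := by
  obtain ⟨c₀, hc₀, h₀⟩ := hV
  have hDS : D ≤ S.card := (hw c₀ hc₀ h₀).trans (Finset.card_filter_le _ _)
  -- `S'` omits `D - 1` points of `S`. A word of `V` vanishing on `S'` has fewer than `D` nonzero
  -- entries on `S`, hence none, so only `S'` counts in the dimension drop.
  obtain ⟨S', hS', hcard⟩ := Finset.exists_subset_card_eq (Nat.sub_le S.card (D - 1))
  have heq : V ⊓ vanishingOn F S = V ⊓ vanishingOn F S' := by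
    refine le_antisymm (fun c hc => ⟨hc.1, ?_⟩) fun c hc => ⟨hc.1, ?_⟩
    · by_contra hne
      rw [SetLike.mem_coe, mem_vanishingOn] at hne
      push Not at hne
      have h1 := hw c hc.1 hne
      have h2 : (S.filter fun i => c i ≠ 0) ⊆ S \ S' := fun i hi =>
        Finset.mem_sdiff.2 ⟨(Finset.mem_filter.1 hi).1, fun hi' =>
          (Finset.mem_filter.1 hi).2 (mem_vanishingOn.1 hc.2 i hi')⟩
      have h3 := Finset.card_le_card h2
      rw [Finset.card_sdiff_of_subset hS'] at h3
      omega
    · exact mem_vanishingOn.2 fun i hi => mem_vanishingOn.1 hc.2 i (hS' hi)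
  have := finrank_le_finrank_inf_vanishingOn_add_card V S'
  rw [← heq] at this
  omega

theorem inf_vanishingOn_inf_sdiff [DecidableEq ι] (C : Submodule F (ι → F)) (A S : Finset ι) :
    C ⊓ vanishingOn F A ⊓ vanishingOn F (S \ A) = C ⊓ vanishingOn F (A ∪ S) := by
  ext c
  simp only [Submodule.mem_inf, mem_vanishingOn, Finset.mem_sdiff, Finset.mem_union, and_assoc]
  refine and_congr_right fun _ => ⟨fun h i hi => ?_, fun h => ⟨fun i hi => h i (Or.inl hi),
    fun i hi => h i (Or.inr hi.1)⟩⟩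
  by_cases hA : i ∈ A
  · exact h.1 i hA
  · exact h.2 i ⟨hi.resolve_left hA, hA⟩

theorem exists_ne_zero_of_lt_finrank {V : Submodule F (ι → F)}
    (h : 0 < Module.finrank F V) : ∃ c ∈ V, ∃ i, c i ≠ 0 := by
  have hV : V ≠ ⊥ := by
    rintro rfl
    simp at h
  obtain ⟨c, hc, h0⟩ := V.exists_mem_ne_zero_of_ne_bot hV
  exact ⟨c, hc, Function.ne_iff.1 h0⟩

end Singleton

/-- The Singleton-type bound for codes with `(r, δ)`-locality. -/
theorem IsLinearLRC.add_le {F : Type*} [Field F] {n k d r δ K : ℕ} {C : Submodule F (Fin n → F)}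
    (hC : IsLinearLRC C k d r δ) (hK : K * r < k) : d + k + K * (δ - 1) ≤ n + 1 := by
  classical
  have hδ := hC.two_le_delta
  -- `A` is the union of `j` locality sets, each chosen through a coordinate where the current
  -- subcode is nonzero. The second inequality says that the zeros exceed the lost dimensions by at
  -- least `j(δ - 1)`.
  have key : ∀ j ≤ K, ∃ A : Finset (Fin n),
      k ≤ Module.finrank F (C ⊓ vanishingOn F A : Submodule F (Fin n → F)) + j * r ∧
      k + j * (δ - 1) ≤
        A.card + Module.finrank F (C ⊓ vanishingOn F A : Submodule F (Fin n → F)) := by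
    intro j
    induction j with
    | zero =>
      intro _
      have : C ⊓ vanishingOn F (∅ : Finset (Fin n)) = C :=
        inf_eq_left.2 fun c _ => mem_vanishingOn.2 (by simp)
      exact ⟨∅, by rw [this, hC.finrank_eq]; simp, by rw [this, hC.finrank_eq]; simp⟩
    | succ j ih =>
      intro hj
      obtain ⟨A, hA1, hA2⟩ := ih (by omega)
      have hjr : j * r ≤ K * r := Nat.mul_le_mul_right _ (by omega)
      obtain ⟨c, hc, i, hi⟩ := exists_ne_zero_of_lt_finrank
        (V := C ⊓ vanishingOn F A) (by omega)
      obtain ⟨S, hiS, hS, hmin⟩ := hC.locality i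
      rw [le_minDist_proj_iff] at hmin
      have hfil (c : Fin n → F) (hc : c ∈ C ⊓ vanishingOn F A) :
          (S.filter fun i => c i ≠ 0) = (S \ A).filter fun i => c i ≠ 0 := by
        ext i
        simp only [Finset.mem_filter, Finset.mem_sdiff]
        exact ⟨fun h => ⟨⟨h.1, fun hA => h.2 (mem_vanishingOn.1 hc.2 i hA)⟩, h.2⟩,
          fun h => ⟨h.1.1, h.2⟩⟩
      have h1 := finrank_add_le_of_le_weight (C ⊓ vanishingOn F A) (S \ A) (D := δ) (by omega)
        ⟨c, hc, i, Finset.mem_sdiff.2 ⟨hiS, fun hA => hi (mem_vanishingOn.1 hc.2 i hA)⟩, hi⟩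
        (fun c hc ⟨i, hi, hci⟩ => by
          rw [← hfil c hc]
          exact hmin c hc.1 ⟨i, (Finset.mem_sdiff.1 hi).1, hci⟩)
      rw [inf_vanishingOn_inf_sdiff] at h1
      refine ⟨A ∪ S, ?_, ?_⟩
      · have := Finset.card_le_card (Finset.sdiff_subset (s := S) (t := A))
        rw [add_mul, one_mul]
        omega
      · rw [← Finset.union_sdiff_self_eq_union, Finset.card_union_of_disjoint
          Finset.disjoint_sdiff, Finset.union_sdiff_self_eq_union, add_mul, one_mul]
        omega
  obtain ⟨A, hA1, hA2⟩ := key K le_rfl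
  have hw : ∀ c ∈ C, c ≠ 0 → d ≤ hammingNorm c := le_minDist_submodule_iff.1 hC.minDist_eq.ge
  have hd : 1 ≤ d := by
    have : ((1 : ℕ) : ℕ∞) ≤ minDist (C : Set (Fin n → F)) :=
      le_minDist_submodule_iff.2 fun c _ h0 => hammingNorm_pos_iff.2 h0
    rw [hC.minDist_eq] at this
    exact_mod_cast this
  obtain ⟨c, hc, i, hi⟩ := exists_ne_zero_of_lt_finrank (V := C ⊓ vanishingOn F A) (by omega)
  have h1 := finrank_add_le_of_le_weight (C ⊓ vanishingOn F A) (Finset.univ \ A) hd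
    ⟨c, hc, i, Finset.mem_sdiff.2 ⟨Finset.mem_univ _,
      fun hA => hi (mem_vanishingOn.1 hc.2 i hA)⟩, hi⟩
    (fun c hc ⟨i, _, hci⟩ => by
      refine (hw c hc.1 (Function.ne_iff.2 ⟨i, hci⟩)).trans (Finset.card_le_card fun i hi => ?_)
      have hci := (Finset.mem_filter.1 hi).2
      exact Finset.mem_filter.2 ⟨Finset.mem_sdiff.2 ⟨Finset.mem_univ _,
        fun hA => hci (mem_vanishingOn.1 hc.2 i hA)⟩, hci⟩)
  have h2 : C ⊓ vanishingOn F (A ∪ Finset.univ) = ⊥ := by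
    rw [eq_bot_iff]
    exact fun c hc => funext fun i => mem_vanishingOn.1 hc.2 i (by simp)
  rw [inf_vanishingOn_inf_sdiff, h2, finrank_bot, Finset.card_univ_sdiff, Fintype.card_fin] at h1
  have h3 := Finset.card_le_univ A
  rw [Fintype.card_fin] at h3
  omega

/-! ### Local sets overlapping along a multigraph. -/

open Finset in
theorem sum_card_filter_eq (b : ℕ) (α : ℕ → ℕ) (J : Finset ℕ) :
    ∑ i ∈ J, #{p ∈ range b | α p = i} = #{p ∈ range b | α p ∈ J} := by
  simp only [card_filter]
  rw [sum_comm]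
  exact sum_congr rfl fun p _ => by rw [sum_ite_eq]

-- Deleting a vertex loses at most `r` edges while the bound drops by exactly `r`, so vertex sets of
-- size `K` suffice.
open Finset in
theorem card_filter_and_add_le_of_degree_le {α β : ℕ → ℕ} {b r k K : ℕ}
    (hdeg : ∀ i, #{p ∈ range b | α p = i} + #{p ∈ range b | β p = i} ≤ r)
    (hJ : ∀ J : Finset ℕ, #J = K → #{p ∈ range b | α p ∈ J ∧ β p ∈ J} + k ≤ K * r) :
    ∀ j, K ≤ j → ∀ J : Finset ℕ, #J = j →
      #{p ∈ range b | α p ∈ J ∧ β p ∈ J} + k ≤ j * r := by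
  intro j hj
  induction j, hj using Nat.le_induction with
  | base => exact hJ
  | succ j hj ih =>
    intro J hJc
    obtain ⟨i, hi⟩ : J.Nonempty := card_pos.1 (by omega)
    have h1 := ih (J.erase i) (by rw [card_erase_of_mem hi, hJc]; rfl)
    have h2 : #{p ∈ range b | α p ∈ J ∧ β p ∈ J} ≤
        #{p ∈ range b | α p ∈ J.erase i ∧ β p ∈ J.erase i} +
        (#{p ∈ range b | α p = i} + #{p ∈ range b | β p = i}) := by
      rw [← add_assoc]
      refine (card_le_card ?_).trans ((card_union_le _ _).trans
        (Nat.add_le_add_right (card_union_le _ _) _))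
      intro p
      simp only [mem_filter, mem_union, mem_erase]
      tauto
    have h3 := hdeg i
    rw [add_mul, one_mul]
    omega

open Finset in
/-- Local sets that overlap pairwise as prescribed by a multigraph: the `p`-th edge stands for a
coordinate common to the local sets `α p` and `β p`. -/
theorem exists_achievable_of_graph {n k r δ M b K D : ℕ} (hr : 1 ≤ r) (hrk : r ≤ k) (hδ : 2 ≤ δ)
    (hn : n + b = M * (r + δ - 1)) (α β : ℕ → ℕ) (hα : ∀ p < b, α p < M) (hβ : ∀ p < b, β p < M)
    (hdeg : ∀ i, #{p ∈ range b | α p = i} + #{p ∈ range b | β p = i} ≤ r)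
    (hJ : ∀ J : Finset ℕ, #J = K + 1 →
      #{p ∈ range b | α p ∈ J ∧ β p ∈ J} + k ≤ (K + 1) * r)
    (hKM : K + 1 ≤ M) (hD : D + k + K * (δ - 1) ≤ n + 1) :
    ∃ d ∈ achievable n k r δ, D ≤ d := by
  set dg : ℕ → ℕ := fun i => #{p ∈ range b | α p = i} + #{p ∈ range b | β p = i} with hdg
  have hsumdg (J : Finset ℕ) : ∑ i ∈ J, dg i =
      #{p ∈ range b | α p ∈ J} + #{p ∈ range b | β p ∈ J} := by
    rw [hdg, sum_add_distrib, sum_card_filter_eq, sum_card_filter_eq]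
  have hsumsub (J : Finset ℕ) : ∑ i ∈ J, (r + δ - 1 - dg i) + ∑ i ∈ J, dg i =
      #J * (r + δ - 1) := by
    rw [← sum_add_distrib, card_eq_sum_ones, sum_mul]
    refine sum_congr rfl fun i _ => ?_
    have := hdeg i
    simp only [hdg]
    omega
  -- One coordinate per edge, and private coordinates that fill each local set up to `r + δ - 1`.
  let Q := Fin b ⊕ Σ i : Fin M, Fin (r + δ - 1 - dg i)
  have hQ : Fintype.card Q = n := by
    simp only [Q, Fintype.card_sum, Fintype.card_fin, Fintype.card_sigma]
    rw [Fin.sum_univ_eq_sum_range fun i => r + δ - 1 - dg i]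
    have h1 := hsumsub (range M)
    rw [hsumdg, filter_true_of_mem fun p hp => mem_range.2 (hα p (mem_range.1 hp)),
      filter_true_of_mem fun p hp => mem_range.2 (hβ p (mem_range.1 hp)), card_range,
      card_range] at h1
    omega
  let e : Fin n ≃ Q := (Fintype.equivFinOfCardEq hQ).symm
  let mem : Q → Finset (Fin M) :=
    Sum.elim (fun p => univ.filter fun i => (i : ℕ) = α p ∨ (i : ℕ) = β p) (fun x => {x.1})
  have hcount (J : Finset (Fin M)) : #{q : Fin n | ∃ i ∈ J, i ∈ mem (e q)} =
      #{p ∈ range b | α p ∈ J.map Fin.valEmbedding ∨ β p ∈ J.map Fin.valEmbedding} +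
      ∑ i ∈ J.map Fin.valEmbedding, (r + δ - 1 - dg i) := by
    rw [card_filter, Equiv.sum_comp e fun x => if ∃ i ∈ J, i ∈ mem x then 1 else 0,
      Fintype.sum_sum_type, Fintype.sum_sigma, sum_map, card_filter, ← Fin.sum_univ_eq_sum_range
        fun p => if α p ∈ J.map Fin.valEmbedding ∨ β p ∈ J.map Fin.valEmbedding then 1 else 0]
    congr 1
    · refine sum_congr rfl fun p _ => ?_
      congr 1
      simp only [mem, Sum.elim_inl, mem_filter, mem_univ, true_and, mem_map,
        Fin.valEmbedding_apply, eq_iff_iff]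
      constructor
      · rintro ⟨i, hi, h | h⟩
        · exact Or.inl ⟨i, hi, h⟩
        · exact Or.inr ⟨i, hi, h⟩
      · rintro (⟨i, hi, h⟩ | ⟨i, hi, h⟩)
        · exact ⟨i, hi, Or.inl h⟩
        · exact ⟨i, hi, Or.inr h⟩
    · simp only [mem, Sum.elim_inr, mem_singleton, exists_eq_right, sum_const, card_univ,
        Fintype.card_fin, smul_eq_mul, mul_ite, mul_one, mul_zero, sum_ite_mem, univ_inter,
        Fin.valEmbedding_apply]
  have hor (J : Finset ℕ) : #{p ∈ range b | α p ∈ J ∨ β p ∈ J} +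
      #{p ∈ range b | α p ∈ J ∧ β p ∈ J} =
      #{p ∈ range b | α p ∈ J} + #{p ∈ range b | β p ∈ J} := by
    rw [filter_or, filter_and, card_union_add_card_inter]
  refine exists_achievable_of_cover (m := M) (K := K) hr hrk hδ (fun q => mem (e q)) ?_ ?_ ?_ hKM hD
  · intro q
    rcases hq : e q with p | x
    · exact ⟨⟨α p, hα p p.2⟩, by simp [mem]⟩
    · exact ⟨x.1, by simp [mem]⟩
  · intro i
    have h1 := hcount {i}
    simp only [mem_singleton, exists_eq_left, map_singleton, Fin.valEmbedding_apply,
      sum_singleton] at h1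
    rw [h1]
    have h2 := hdeg i
    have h3 := card_union_le {p ∈ range b | α p = i} {p ∈ range b | β p = i}
    rw [← filter_or] at h3
    simp only [hdg]
    omega
  · intro J hJc
    rw [hcount]
    -- By inclusion-exclusion `J` covers `#J * (r + δ - 1)` coordinates minus the number of edges
    -- that it spans.
    have h1 := hor (J.map Fin.valEmbedding)
    have h2 := hsumdg (J.map Fin.valEmbedding)
    have h3 := hsumsub (J.map Fin.valEmbedding)
    have h4 := card_filter_and_add_le_of_degree_le hdeg hJ #J hJc (J.map Fin.valEmbedding)
      (card_map _)
    rw [card_map, show r + δ - 1 = r + (δ - 1) by omega, mul_add] at h3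
    rw [show r + δ - 1 = r + (δ - 1) by omega]
    omega

open Finset in
/-- Two local sets overlap, the others are disjoint from them and from each other. -/
theorem exists_achievable_of_one_overlap {n k r δ M b K D : ℕ} (hr : 1 ≤ r) (hrk : r ≤ k)
    (hδ : 2 ≤ δ) (hn : n + b = M * (r + δ - 1)) (hbr : b ≤ r) (hbk : b + k ≤ (K + 1) * r)
    (hKM : K + 1 ≤ M) (hM : 2 ≤ M) (hD : D + k + K * (δ - 1) ≤ n + 1) :
    ∃ d ∈ achievable n k r δ, D ≤ d := by
  refine exists_achievable_of_graph hr hrk hδ hn (fun _ => 0) (fun _ => 1) (fun _ _ => by omega)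
    (fun _ _ => by omega) (fun i => ?_) (fun J _ => ?_) hKM hD
  · rw [filter_const, filter_const]
    split_ifs with h0 h1 h1
    · omega
    · simpa using hbr
    · simpa using hbr
    · simp
  · have := card_filter_le (range b) fun _ => 0 ∈ J ∧ 1 ∈ J
    rw [card_range] at this
    omega

/-! ### Paths and unions of paths. -/

theorem card_filter_div_eq_le {w : ℕ} (hw : 0 < w) (S : Finset ℕ) (i : ℕ) :
    (S.filter fun p => p / w = i).card ≤ w := by
  have h : (S.filter fun p => p / w = i) ⊆ Finset.Ico (i * w) (i * w + w) := by
    intro p hp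
    have h1 := (Finset.mem_filter.1 hp).2
    have h2 := Nat.div_add_mod p w
    have h3 := Nat.mod_lt p hw
    rw [h1, mul_comm] at h2
    exact Finset.mem_Ico.2 ⟨by omega, by omega⟩
  simpa using Finset.card_le_card h

open Finset in
/-- The local sets form a path, and consecutive ones overlap in `w` coordinates. -/
theorem exists_achievable_of_path {n k r δ M b w D : ℕ} (hr : 1 ≤ r) (hrk : r ≤ k)
    (hδ : 2 ≤ δ) (hn : n + b = M * (r + δ - 1)) (hw : 0 < w) (hwr : 2 * w ≤ r)
    (hwk : w + k ≤ 2 * r) (hbM : ∀ p < b, p / w + 1 < M) (hM : 2 ≤ M)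
    (hD : D + k + (δ - 1) ≤ n + 1) :
    ∃ d ∈ achievable n k r δ, D ≤ d := by
  refine exists_achievable_of_graph (K := 1) hr hrk hδ hn (fun p => p / w) (fun p => p / w + 1)
    (fun p hp => (Nat.lt_succ_self _).trans (hbM p hp)) hbM (fun i => ?_) (fun J hJ => ?_) hM
    (by omega)
  · have h1 := card_filter_div_eq_le hw (range b) i
    have h2 : #{p ∈ range b | p / w + 1 = i} ≤ #{p ∈ range b | p / w = i - 1} :=
      card_le_card (monotone_filter_right _ fun p _ hp => by
        exact Nat.eq_sub_of_add_eq hp)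
    have h3 := card_filter_div_eq_le hw (range b) (i - 1)
    exact (add_le_add h1 (h2.trans h3)).trans (by omega)
  · obtain ⟨x, y, hxy, rfl⟩ := card_eq_two.1 hJ
    have h1 : #{p ∈ range b | p / w ∈ ({x, y} : Finset ℕ) ∧ p / w + 1 ∈ ({x, y} : Finset ℕ)} ≤
        #{p ∈ range b | p / w = min x y} :=
      card_le_card (monotone_filter_right _ fun p _ hp => by
        simp only [mem_insert, mem_singleton] at hp
        show p / w = min x y
        omega)
    have h2 := card_filter_div_eq_le hw (range b) (min x y)
    omega

open Finset in
/-- In a disjoint union of paths, of which the first has `t + m` edges and the others have `t`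
edges, a set of vertices whose size is bounded spans few edges. -/
theorem card_filter_path_le {t m h b : ℕ} (ht : 0 < t) {J : Finset ℕ}
    (hJ : #J = h * t + m + h + 1) :
    #{p ∈ range b | p + (p - m) / t ∈ J ∧ p + (p - m) / t + 1 ∈ J} ≤ h * t + m := by
  -- `(p - m) / t` is the number of the path containing edge `p`. Truncated subtraction puts the
  -- first `m` edges into path 0 as well, which therefore has `t + m` edges.
  have hmono {p q : ℕ} (hpq : p ≤ q) : (p - m) / t ≤ (q - m) / t :=
    Nat.div_le_div_right (by omega)
  set E := {p ∈ range b | p + (p - m) / t ∈ J ∧ p + (p - m) / t + 1 ∈ J} with hE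
  set H := E.image fun p => (p - m) / t with hH
  have h1 : #E + #H ≤ #J := by
    -- `E'` holds the first chosen edge of each path. Its lower end is not the upper end of a chosen
    -- edge, so every path met contributes one vertex beyond its edges.
    let E' := E.filter fun p => ∀ q ∈ E, (q - m) / t = (p - m) / t → p ≤ q
    have hH' : #H ≤ #E' := by
      have : H ⊆ E'.image fun p => (p - m) / t := by
        intro c hc
        obtain ⟨p, hp, rfl⟩ := mem_image.1 hc
        obtain ⟨q, hq, hmin⟩ := exists_min_image (E.filter fun q => (q - m) / t = (p - m) / t) id
          ⟨p, mem_filter.2 ⟨hp, rfl⟩⟩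
        rw [mem_filter] at hq
        exact mem_image.2 ⟨q, mem_filter.2 ⟨hq.1, fun q' hq' h =>
          hmin q' (mem_filter.2 ⟨hq', h.trans hq.2⟩)⟩, hq.2⟩
      exact (card_le_card this).trans card_image_le
    have hα : #(E'.image fun p => p + (p - m) / t) = #E' :=
      card_image_of_injective _ fun p q hpq => by
        rcases le_total p q with h | h <;> have := hmono h <;> omega
    have hβ : #(E.image fun p => p + (p - m) / t + 1) = #E :=
      card_image_of_injective _ fun p q hpq => by
        rcases le_total p q with h | h <;> have := hmono h <;> omega
    have hdisj : Disjoint (E.image fun p => p + (p - m) / t + 1)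
        (E'.image fun p => p + (p - m) / t) := by
      rw [disjoint_left]
      intro v hv hv'
      obtain ⟨q, hq, rfl⟩ := mem_image.1 hv
      obtain ⟨p, hp, hpq⟩ := mem_image.1 hv'
      have hp' := (mem_filter.1 hp).2 q hq
      rcases le_or_gt p q with h | h
      · have := hmono h
        omega
      · have := hmono h.le
        have := hp' (by omega)
        omega
    have hsub : (E.image fun p => p + (p - m) / t + 1) ∪ (E'.image fun p => p + (p - m) / t) ⊆ J := by
      refine union_subset (image_subset_iff.2 fun p hp => (mem_filter.1 hp).2.2)
        (image_subset_iff.2 fun p hp => (mem_filter.1 (mem_filter.1 hp).1).2.1)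
    have := card_le_card hsub
    rw [card_union_of_disjoint hdisj] at this
    omega
  -- If more than `h` paths are met, the vertex count bounds the edges; if at most `h`, their total
  -- length does.
  rcases Nat.lt_or_ge h #H with hle | hle
  · omega
  · have h2 : #E ≤ #{p ∈ E | p < m} + #{p ∈ E | ¬ p < m} :=
      (card_filter_add_card_filter_not _).ge
    have h3 : #{p ∈ E | p < m} ≤ m := by
      simpa using card_le_card (show {p ∈ E | p < m} ⊆ range m from fun p hp =>
        mem_range.2 (mem_filter.1 hp).2)
    have h4 : #{p ∈ E | ¬ p < m} ≤ t * #H := by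
      refine (card_le_mul_card_image (f := fun p => (p - m) / t) _ t fun c _ => ?_).trans
        (Nat.mul_le_mul_left _ (card_le_card (image_subset_image (filter_subset _ _))))
      rw [← card_image_of_injOn (f := fun p => p - m)]
      · refine (card_le_card ?_).trans (card_filter_div_eq_le ht (range b) c)
        refine image_subset_iff.2 fun p hp => ?_
        simp only [mem_filter, hE, mem_range] at hp ⊢
        exact ⟨by omega, hp.2⟩
      · intro p hp q hq hpq
        simp only [coe_filter, Set.mem_ofPred_eq, mem_filter] at hp hq hpq
        omega
    have h5 : t * #H ≤ t * h := Nat.mul_le_mul_left _ hle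
    rw [mul_comm h t]
    omega

open Finset in
/-- The local sets form disjoint paths, and consecutive ones in a path share one coordinate. -/
theorem exists_achievable_of_paths {n k r δ M b K D t m h : ℕ} (hr : 2 ≤ r) (hrk : r ≤ k)
    (hδ : 2 ≤ δ) (hn : n + b = M * (r + δ - 1)) (ht : 0 < t) (hK : K = h * t + m + h)
    (hk : h * t + m + k ≤ (K + 1) * r) (hbM : ∀ p < b, p + (p - m) / t + 1 < M) (hKM : K + 1 ≤ M)
    (hD : D + k + K * (δ - 1) ≤ n + 1) :
    ∃ d ∈ achievable n k r δ, D ≤ d := by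
  have hmono {p q : ℕ} (hpq : p ≤ q) : (p - m) / t ≤ (q - m) / t :=
    Nat.div_le_div_right (by omega)
  refine exists_achievable_of_graph (by omega) hrk hδ hn (fun p => p + (p - m) / t)
    (fun p => p + (p - m) / t + 1) (fun p hp => (Nat.lt_succ_self _).trans (hbM p hp)) hbM
    (fun i => ?_) (fun J hJ => ?_) hKM hD
  · have h1 : #{p ∈ range b | p + (p - m) / t = i} ≤ 1 := card_le_one.2 fun p hp q hq => by
      have hp := (mem_filter.1 hp).2
      have hq := (mem_filter.1 hq).2
      rcases le_total p q with h | h <;> have := hmono h <;> omega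
    have h2 : #{p ∈ range b | p + (p - m) / t + 1 = i} ≤ 1 := card_le_one.2 fun p hp q hq => by
      have hp := (mem_filter.1 hp).2
      have hq := (mem_filter.1 hq).2
      rcases le_total p q with h | h <;> have := hmono h <;> omega
    omega
  · have := card_filter_path_le (b := b) ht (hJ.trans (congrArg (· + 1) hK))
    omega

/-! ### Theta graphs. -/

section Theta

open Finset

theorem sum_range_mul_eq {A : Type*} [AddCommMonoid A] (f : ℕ → A) (Q w : ℕ) :
    ∑ x ∈ range (Q * w), f x = ∑ c ∈ range Q, ∑ i ∈ range w, f (c * w + i) := by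
  induction Q with
  | zero => simp
  | succ Q ih => rw [add_mul, one_mul, sum_range_add, ih, sum_range_succ]

/-- The `j`-th vertex of the `l`-th path, when paths with `v` inner vertices are glued at their
ends `0` and `v + 1`. -/
def thetaVertex (v l j : ℕ) : ℕ :=
  -- The inner vertices of path `l > 0` get the `v` labels from `l * v + 2` on, so an initial run of
  -- edges uses an initial run of labels.
  if l = 0 then j else if j = 0 then 0 else if j = v + 1 then v + 1 else l * v + j + 1

theorem thetaVertex_zero (v l : ℕ) : thetaVertex v l 0 = 0 := by
  simp [thetaVertex]

theorem thetaVertex_end (v l : ℕ) : thetaVertex v l (v + 1) = v + 1 := by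
  simp [thetaVertex]

theorem sum_range_theta (f : ℕ → ℕ) (v t : ℕ) :
    ∑ x ∈ range ((t + 1) * v + 2), f x =
      f 0 + f (v + 1) + ∑ l ∈ range (t + 1), ∑ j ∈ range v, f (thetaVertex v l (j + 1)) := by
  induction t with
  | zero =>
    rw [zero_add, one_mul, sum_range_succ, sum_range_succ', sum_range_one]
    simp only [thetaVertex, if_true]
    ring
  | succ t ih =>
    rw [show (t + 1 + 1) * v + 2 = (t + 1) * v + 2 + v by ring, sum_range_add, ih,
      sum_range_succ _ (t + 1), add_assoc (f 0 + f (v + 1))]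
    congr 2
    refine sum_congr rfl fun j hj => ?_
    have := mem_range.1 hj
    rw [thetaVertex, if_neg (by omega), if_neg (by omega), if_neg (by omega)]
    congr 1
    ring

/-- Counts the vertices needed by the first `X` edges: a complete path has one inner vertex fewer
than edges, and the second end is extra only once some path is complete. This is the source of `y`
in (iv). -/
theorem thetaVertex_lt {v l j j' X : ℕ} (hj : j < v + 1) (hj' : j' = j ∨ j' = j + 1)
    (hX : l * (v + 1) + j < X) :
    thetaVertex v l j' < X - X / (v + 1) + 1 + min (X / (v + 1)) 1 := by
  obtain ⟨m, hm⟩ : ∃ m, m = X / (v + 1) := ⟨_, rfl⟩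
  obtain ⟨ε, hε⟩ : ∃ ε, ε = X % (v + 1) := ⟨_, rfl⟩
  have h1 : m * v + m + ε = X := by
    rw [hm, hε, ← Nat.mul_succ, mul_comm]
    exact Nat.div_add_mod X (v + 1)
  have h2 : ε < v + 1 := hε ▸ Nat.mod_lt _ (by omega)
  rw [← hm]
  rw [mul_add, mul_one] at hX
  have h3 : l ≤ m := by
    by_contra! h
    have := Nat.mul_le_mul_right v (Nat.succ_le_of_lt h)
    rw [Nat.succ_mul] at this
    omega
  have h4 : l = m ∨ l * v + v ≤ m * v := by
    rcases h3.eq_or_lt with h | h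
    · exact Or.inl h
    · exact Or.inr (by rw [← Nat.succ_mul]; exact Nat.mul_le_mul_right v h)
  have h5 : m = 0 ∨ v ≤ m * v := by
    rcases Nat.eq_zero_or_pos m with h | h
    · exact Or.inl h
    · exact Or.inr (Nat.le_mul_of_pos_left v h)
  rw [thetaVertex]
  split_ifs with h6 h7 h8
  · subst h6
    rcases h5 with h5 | h5
    · subst h5
      omega
    · rcases Nat.eq_zero_or_pos m with h | h
      · subst h
        omega
      · omega
  · omega
  · omega
  · rcases h4 with h4 | h4
    · subst h4
      omega
    · omega

variable {f : ℕ → ℕ}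

theorem sum_range_mul_succ_add (f : ℕ → ℕ) (hf : ∀ j, f j ≤ 1) (v : ℕ) :
    ∑ j ∈ range (v + 1), f j * f (j + 1) + ∑ j ∈ range (v + 1), (1 - f j) * f (j + 1) =
      ∑ j ∈ range v, f (j + 1) + f (v + 1) := by
  rw [← sum_add_distrib, ← sum_range_succ]
  refine sum_congr rfl fun j _ => ?_
  rw [← add_mul, Nat.add_sub_cancel' (hf j), one_mul]

theorem sum_range_mul_succ_add' (f : ℕ → ℕ) (hf : ∀ j, f j ≤ 1) (v : ℕ) :
    ∑ j ∈ range (v + 1), f j * f (j + 1) + ∑ j ∈ range (v + 1), f j * (1 - f (j + 1)) =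
      f 0 + ∑ j ∈ range v, f (j + 1) := by
  rw [← sum_add_distrib, add_comm (f 0), ← sum_range_succ' f]
  refine sum_congr rfl fun j _ => ?_
  rw [← mul_add, Nat.add_sub_cancel' (hf _), mul_one]

/-- The number of edges that a set of vertices of a path spans, when the first vertex is not in the
set. -/
theorem path_edges_le_of_first_zero (hf : ∀ j, f j ≤ 1) {v : ℕ} (h0 : f 0 = 0) :
    ∑ j ∈ range (v + 1), f j * f (j + 1) ≤ ∑ j ∈ range v, f (j + 1) - 1 + f (v + 1) := by
  have h1 := sum_range_mul_succ_add f hf v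
  rcases Nat.eq_zero_or_pos (∑ j ∈ range (v + 1), (1 - f j) * f (j + 1)) with h | h
  · have h2 : ∀ j ≤ v + 1, f j = 0 := by
      intro j
      induction j with
      | zero => exact fun _ => h0
      | succ j ih =>
        intro hj
        have := sum_eq_zero_iff.1 h j (mem_range.2 (by omega))
        rw [ih (by omega)] at this
        simpa using this
    rw [sum_eq_zero fun j hj => by rw [h2 j (mem_range.1 hj).le, zero_mul]]
    exact Nat.zero_le _
  · omega

theorem path_edges_le_of_end_zero (hf : ∀ j, f j ≤ 1) {v : ℕ} (h0 : f 0 = 0 ∨ f (v + 1) = 0) :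
    ∑ j ∈ range (v + 1), f j * f (j + 1) ≤ ∑ j ∈ range v, f (j + 1) := by
  have h1 := sum_range_mul_succ_add f hf v
  have h2 := sum_range_mul_succ_add' f hf v
  omega

/-- From a selected first vertex, a path either leaves the set somewhere, which costs an edge, or is
selected entirely. -/
theorem path_edges_le (hf : ∀ j, f j ≤ 1) {v : ℕ} (h0 : f 0 = 1) :
    ∑ j ∈ range (v + 1), f j * f (j + 1) ≤ ∑ j ∈ range v, f (j + 1) +
      if ∑ j ∈ range v, f (j + 1) = v then 1 else 0 := by
  have h1 := sum_range_mul_succ_add' f hf v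
  split_ifs with h
  · omega
  · rcases Nat.eq_zero_or_pos (∑ j ∈ range (v + 1), f j * (1 - f (j + 1))) with h' | h'
    · refine absurd ?_ h
      have h2 : ∀ j ≤ v + 1, f j = 1 := by
        intro j
        induction j with
        | zero => exact fun _ => h0
        | succ j ih =>
          intro hj
          have h3 := sum_eq_zero_iff.1 h' j (mem_range.2 (by omega))
          rw [ih (by omega), one_mul] at h3
          have := hf (j + 1)
          omega
      rw [sum_congr rfl fun j hj => h2 (j + 1) (by have := mem_range.1 hj; omega)]
      simp
    · omega

/-- A small set of vertices of a theta graph spans a forest. -/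
theorem theta_edges_le (hf : ∀ j, f j ≤ 1) {v t : ℕ}
    (hN : ∑ x ∈ range ((t + 1) * v + 2), f x ≤ 2 * v + 1) :
    ∑ l ∈ range (t + 1), ∑ j ∈ range (v + 1), f (thetaVertex v l j) * f (thetaVertex v l (j + 1)) ≤
      ∑ x ∈ range ((t + 1) * v + 2), f x - 1 := by
  rw [sum_range_theta] at hN ⊢
  set I : ℕ → ℕ := fun l => ∑ j ∈ range v, f (thetaVertex v l (j + 1)) with hI
  set e : ℕ → ℕ := fun l =>
    ∑ j ∈ range (v + 1), f (thetaVertex v l j) * f (thetaVertex v l (j + 1)) with he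
  have h0 := hf 0
  have h1 := hf (v + 1)
  change f 0 + f (v + 1) + ∑ l ∈ range (t + 1), I l ≤ 2 * v + 1 at hN
  change ∑ l ∈ range (t + 1), e l ≤ f 0 + f (v + 1) + ∑ l ∈ range (t + 1), I l - 1
  -- With neither end selected, each path that is met loses an edge. With one end, that end is the
  -- surplus vertex. With both, a cycle would need two full paths, hence `2 * v + 2` vertices.
  by_cases hA : f 0 = 0 ∧ f (v + 1) = 0
  · have hel (l : ℕ) : e l ≤ I l - 1 := by
      have := path_edges_le_of_first_zero (f := fun j => f (thetaVertex v l j)) (fun _ => hf _)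
        (v := v) (by rw [thetaVertex_zero, hA.1])
      simpa only [thetaVertex_end, hA.2, add_zero] using this
    rw [hA.1, hA.2, add_zero, zero_add]
    rcases Nat.eq_zero_or_pos (∑ l ∈ range (t + 1), I l) with h | h
    · rw [sum_eq_zero fun l hl => ?_]
      · exact Nat.zero_le _
      · have h2 := sum_eq_zero_iff.1 h l hl
        have h3 := hel l
        change e l = 0
        omega
    · obtain ⟨l, hl, hpos⟩ : ∃ l ∈ range (t + 1), 0 < I l := by
        by_contra! h'
        exact h.ne' (sum_eq_zero fun l hl => by simpa using h' l hl)
      have h2 : ∑ l ∈ range (t + 1), e l < ∑ l ∈ range (t + 1), I l :=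
        sum_lt_sum (fun l _ => (hel l).trans (Nat.sub_le _ _))
          ⟨l, hl, lt_of_le_of_lt (hel l) (by omega)⟩
      omega
  by_cases hB : f 0 = 0 ∨ f (v + 1) = 0
  · have h2 : ∑ l ∈ range (t + 1), e l ≤ ∑ l ∈ range (t + 1), I l :=
      sum_le_sum fun l _ => path_edges_le_of_end_zero (f := fun j => f (thetaVertex v l j))
        (fun _ => hf _) (by rwa [thetaVertex_zero, thetaVertex_end])
    omega
  · have h2 : ∑ l ∈ range (t + 1), e l ≤
        ∑ l ∈ range (t + 1), (I l + if I l = v then 1 else 0) :=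
      sum_le_sum fun l _ => path_edges_le (f := fun j => f (thetaVertex v l j))
        (fun _ => hf _) (by rw [thetaVertex_zero]; omega)
    rw [sum_add_distrib, ← card_filter (fun l => I l = v)] at h2
    have h3 : #{l ∈ range (t + 1) | I l = v} * v ≤ ∑ l ∈ range (t + 1), I l := by
      rw [← smul_eq_mul, ← sum_const]
      refine (sum_le_sum fun l hl => (mem_filter.1 hl).2.ge).trans
        (sum_le_sum_of_subset (filter_subset _ _))
    have h4 : #{l ∈ range (t + 1) | I l = v} ≤ 1 := by
      by_contra! h
      have := Nat.mul_le_mul_right v h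
      omega
    omega

/-- Inner vertices have degree 2 and the ends degree `t + 1`; taking `f` to be the indicator of a
vertex bounds its degree. -/
theorem theta_degree_le {v t : ℕ} (ht : 1 ≤ t) :
    ∑ l ∈ range (t + 1), ∑ j ∈ range (v + 1),
      (f (thetaVertex v l j) + f (thetaVertex v l (j + 1))) ≤
      (t + 1) * ∑ x ∈ range ((t + 1) * v + 2), f x := by
  rw [sum_range_theta]
  set I : ℕ → ℕ := fun l => ∑ j ∈ range v, f (thetaVertex v l (j + 1)) with hI
  have h1 (l : ℕ) : ∑ j ∈ range (v + 1), (f (thetaVertex v l j) + f (thetaVertex v l (j + 1))) =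
      2 * I l + (f 0 + f (v + 1)) := by
    rw [sum_add_distrib, sum_range_succ' fun j => f (thetaVertex v l j),
      sum_range_succ fun j => f (thetaVertex v l (j + 1)), thetaVertex_zero, thetaVertex_end]
    simp only [hI]
    ring
  simp only [h1]
  rw [sum_add_distrib, ← mul_sum, sum_const, card_range, smul_eq_mul, add_comm]
  exact (Nat.add_le_add_left (Nat.mul_le_mul_right _ (by omega)) _).trans_eq (mul_add _ _ _).symm

/-- The end number `ε` of the `e`-th edge in a sequence of theta graphs. -/
def thetaEnd (v t e ε : ℕ) : ℕ :=
  e / (t * (v + 1)) * (t * v + 2) +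
    thetaVertex v (e % (t * (v + 1)) / (v + 1)) (e % (t * (v + 1)) % (v + 1) + ε)

theorem thetaEnd_eq {v t c l j ε : ℕ} (hl : l < t) (hj : j < v + 1) :
    thetaEnd v t (c * (t * (v + 1)) + (l * (v + 1) + j)) ε =
      c * (t * v + 2) + thetaVertex v l (j + ε) := by
  have h1 : l * (v + 1) + j < t * (v + 1) := by
    have := Nat.mul_le_mul_right (v + 1) (Nat.succ_le_of_lt hl)
    rw [Nat.succ_mul] at this
    omega
  have hpos : 0 < t * (v + 1) := by omega
  have hdiv {c w i : ℕ} (hi : i < w) : (c * w + i) / w = c ∧ (c * w + i) % w = i := by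
    rw [mul_comm c w, Nat.mul_add_div (by omega), Nat.div_eq_of_lt hi, Nat.mul_add_mod,
      Nat.mod_eq_of_lt hi]
    exact ⟨rfl, rfl⟩
  rw [thetaEnd, (hdiv h1).1, (hdiv h1).2, (hdiv hj).1, (hdiv hj).2]

/-- Each edge is repeated `s` times through `p / s`. An incomplete last theta graph may be
completed, as all terms are nonnegative. -/
theorem sum_theta_le (f : ℕ → ℕ → ℕ) (g : ℕ → ℕ) (b s t v Q : ℕ) (hb : b ≤ Q * (t * (v + 1)) * s)
    (hg : ∀ c < Q, ∑ l ∈ range t, ∑ j ∈ range (v + 1),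
      f (c * (t * v + 2) + thetaVertex v l j) (c * (t * v + 2) + thetaVertex v l (j + 1)) ≤ g c) :
    ∑ p ∈ range b, f (thetaEnd v t (p / s) 0) (thetaEnd v t (p / s) 1) ≤
      s * ∑ c ∈ range Q, g c := by
  rcases Nat.eq_zero_or_pos s with rfl | hs
  · have : b = 0 := by omega
    simp [this]
  refine (sum_le_sum_of_subset (range_subset_range.2 hb)).trans ?_
  rw [sum_range_mul_eq, sum_congr rfl fun e _ => sum_congr rfl fun i hi => by
    rw [mul_comm e s, Nat.mul_add_div hs, Nat.div_eq_of_lt (mem_range.1 hi), add_zero]]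
  simp only [sum_const, card_range, smul_eq_mul]
  rw [← mul_sum, sum_range_mul_eq]
  refine Nat.mul_le_mul_left _ (sum_le_sum fun c hc => ?_)
  rw [sum_range_mul_eq]
  refine le_trans (le_of_eq ?_) (hg c (mem_range.1 hc))
  refine sum_congr rfl fun l hl => sum_congr rfl fun j hj => ?_
  rw [thetaEnd_eq (mem_range.1 hl) (mem_range.1 hj), thetaEnd_eq (mem_range.1 hl) (mem_range.1 hj),
    add_zero]

theorem thetaEnd_lt_mul {v t q e ε : ℕ} (ht : 1 ≤ t) (hε : ε ≤ 1) (he : e < q * (t * (v + 1))) :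
    thetaEnd v t e ε < q * (t * v + 2) := by
  have hpos : 0 < t * (v + 1) := Nat.mul_pos ht (Nat.succ_pos v)
  have h1 : e / (t * (v + 1)) < q := (Nat.div_lt_iff_lt_mul hpos).2 he
  have h2 := thetaVertex_lt (v := v) (l := e % (t * (v + 1)) / (v + 1))
    (j := e % (t * (v + 1)) % (v + 1)) (j' := e % (t * (v + 1)) % (v + 1) + ε) (X := t * (v + 1))
    (Nat.mod_lt _ (Nat.succ_pos v)) (by omega)
    (by rw [mul_comm, Nat.div_add_mod]; exact Nat.mod_lt _ hpos)
  have h4 : t * (v + 1) - t + 1 + 1 = t * v + 2 := by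
    rw [mul_add]
    omega
  rw [Nat.mul_div_cancel _ (Nat.succ_pos v), min_eq_right ht, h4] at h2
  have h3 := Nat.mul_le_mul_right (t * v + 2) (Nat.succ_le_of_lt h1)
  rw [Nat.succ_mul] at h3
  rw [thetaEnd]
  omega

theorem thetaEnd_lt {v t q e ε X : ℕ} (ht : 1 ≤ t) (hε : ε ≤ 1) (hX : X ≤ t * (v + 1))
    (he : e < q * (t * (v + 1)) + X) :
    thetaEnd v t e ε < q * (t * v + 2) + (X - X / (v + 1) + 1 + min (X / (v + 1)) 1) := by
  rcases Nat.lt_or_ge e (q * (t * (v + 1))) with h | h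
  · exact (thetaEnd_lt_mul ht hε h).trans_le (Nat.le_add_right _ _)
  · have hlt : e < (q + 1) * (t * (v + 1)) := by
      rw [Nat.succ_mul]
      omega
    have hdiv : e / (t * (v + 1)) = q := Nat.div_eq_of_lt_le h hlt
    have hmod := Nat.div_add_mod e (t * (v + 1))
    rw [hdiv, mul_comm] at hmod
    rw [thetaEnd, hdiv]
    refine Nat.add_lt_add_left (thetaVertex_lt (j := e % (t * (v + 1)) % (v + 1))
      (Nat.mod_lt _ (Nat.succ_pos v)) (by omega) ?_) _
    rw [mul_comm, Nat.div_add_mod]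
    omega

/-- The local sets form a disjoint union of theta graphs, and adjacent ones overlap in `s`
coordinates. -/
theorem exists_achievable_of_theta {n k r δ M b K D s t v : ℕ} (hr : 1 ≤ r) (hrk : r ≤ k)
    (hδ : 2 ≤ δ) (hn : n + b = M * (r + δ - 1)) (hs : 0 < s) (ht : 2 ≤ t) (hst : s * t ≤ r)
    (hKv : K ≤ 2 * v) (hsk : s * K + k ≤ (K + 1) * r)
    (hbM : ∀ e ε, e * s < b → ε ≤ 1 → thetaEnd v t e ε < M) (hKM : K + 1 ≤ M)
    (hD : D + k + K * (δ - 1) ≤ n + 1) :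
    ∃ d ∈ achievable n k r δ, D ≤ d := by
  obtain ⟨t, rfl⟩ : ∃ t', t = t' + 1 := ⟨t - 1, by omega⟩
  -- Only an upper bound for the number of theta graphs is needed, and `b` is a crude one.
  have hbQ : b ≤ b * ((t + 1) * (v + 1)) * s := by
    rw [mul_assoc]
    exact Nat.le_mul_of_pos_right _ (by positivity)
  have hp {p : ℕ} (hp : p < b) : p / s * s < b := (Nat.div_mul_le_self p s).trans_lt hp
  let χ (J : Finset ℕ) (x : ℕ) : ℕ := if x ∈ J then 1 else 0
  have hχ (J : Finset ℕ) (x : ℕ) : χ J x ≤ 1 := by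
    simp only [χ]
    split_ifs <;> omega
  have hsum (J : Finset ℕ) : ∑ c ∈ range b, ∑ x ∈ range ((t + 1) * v + 2),
      χ J (c * ((t + 1) * v + 2) + x) ≤ #J := by
    rw [← sum_range_mul_eq]
    simp only [χ]
    rw [← card_filter]
    exact card_le_card fun x hx => (mem_filter.1 hx).2
  have hterm (J : Finset ℕ) {c : ℕ} (hc : c < b) :
      ∑ x ∈ range ((t + 1) * v + 2), χ J (c * ((t + 1) * v + 2) + x) ≤ #J :=
    (single_le_sum (f := fun c => ∑ x ∈ range ((t + 1) * v + 2), χ J (c * ((t + 1) * v + 2) + x))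
      (fun _ _ => Nat.zero_le _) (mem_range.2 hc)).trans (hsum J)
  refine exists_achievable_of_graph hr hrk hδ hn (fun p => thetaEnd v (t + 1) (p / s) 0)
    (fun p => thetaEnd v (t + 1) (p / s) 1) (fun p h => hbM _ _ (hp h) (by omega))
    (fun p h => hbM _ _ (hp h) (by omega)) (fun i => ?_) (fun J hJ => ?_) hKM hD
  · have h1 := sum_theta_le (fun x y => χ {i} x + χ {i} y)
      (fun c => (t + 1) * ∑ x ∈ range ((t + 1) * v + 2), χ {i} (c * ((t + 1) * v + 2) + x))
      b s (t + 1) v b hbQ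
      (fun c _ => theta_degree_le (f := fun x => χ {i} (c * ((t + 1) * v + 2) + x)) (by omega))
    rw [← mul_sum, ← mul_assoc, sum_add_distrib] at h1
    have h2 := Nat.mul_le_mul_left (s * (t + 1)) (hsum {i})
    rw [card_singleton, mul_one] at h2
    simp only [χ, mem_singleton] at h1 h2
    rw [card_filter, card_filter]
    exact h1.trans (h2.trans hst)
  · have h1 := sum_theta_le (fun x y => χ J x * χ J y)
      (fun c => ∑ x ∈ range ((t + 1) * v + 2), χ J (c * ((t + 1) * v + 2) + x) - 1)
      b s (t + 1) v b hbQ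
      (fun c hc => theta_edges_le (f := fun x => χ J (c * ((t + 1) * v + 2) + x))
        (fun _ => hχ J _) ((hterm J hc).trans (by omega)))
    have h2 : #{p ∈ range b | thetaEnd v (t + 1) (p / s) 0 ∈ J ∧
        thetaEnd v (t + 1) (p / s) 1 ∈ J} =
        ∑ p ∈ range b, χ J (thetaEnd v (t + 1) (p / s) 0) * χ J (thetaEnd v (t + 1) (p / s) 1) := by
      rw [card_filter]
      refine sum_congr rfl fun p _ => ?_
      simp only [χ]
      split_ifs <;> simp_all
    -- In a forest every component met saves one edge; one such component already gives `K` from `K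
    -- + 1` vertices.
    have h3 : ∑ c ∈ range b,
        (∑ x ∈ range ((t + 1) * v + 2), χ J (c * ((t + 1) * v + 2) + x) - 1) ≤ K := by
      by_cases h0 : ∃ c ∈ range b,
          0 < ∑ x ∈ range ((t + 1) * v + 2), χ J (c * ((t + 1) * v + 2) + x)
      · obtain ⟨c, hc, h0⟩ := h0
        have h4 := sum_lt_sum (s := range b) (f := fun c =>
          ∑ x ∈ range ((t + 1) * v + 2), χ J (c * ((t + 1) * v + 2) + x) - 1)
          (fun c _ => Nat.sub_le _ 1) ⟨c, hc, Nat.sub_lt h0 one_pos⟩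
        have h5 := hsum J
        omega
      · push Not at h0
        rw [sum_eq_zero fun c hc => by rw [Nat.le_zero.1 (h0 c hc), Nat.zero_sub]]
        exact Nat.zero_le _
    have h4 := Nat.mul_le_mul_left s h3
    rw [h2]
    omega

end Theta

/-! ### Rounding, and the cases in natural-number parameters. -/

theorem ceil_div_spec {x y z : ℤ} (hy : 0 < y) (h : z = ⌈(x : ℚ) / (y : ℚ)⌉) :
    (z - 1) * y < x ∧ x ≤ z * y := by
  have hy' : (0 : ℚ) < y := by exact_mod_cast hy
  have h1 := Int.le_ceil ((x : ℚ) / (y : ℚ))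
  have h2 := Int.ceil_lt_add_one ((x : ℚ) / (y : ℚ))
  rw [← h] at h1 h2
  rw [div_le_iff₀ hy'] at h1
  rw [← sub_lt_iff_lt_add, lt_div_iff₀ hy'] at h2
  exact ⟨by exact_mod_cast h2, by exact_mod_cast h1⟩

theorem floor_div_spec {x y z : ℤ} (hy : 0 < y) (h : z = ⌊(x : ℚ) / (y : ℚ)⌋) :
    z * y ≤ x ∧ x < (z + 1) * y := by
  have hy' : (0 : ℚ) < y := by exact_mod_cast hy
  have h1 := Int.floor_le ((x : ℚ) / (y : ℚ))
  have h2 := Int.lt_floor_add_one ((x : ℚ) / (y : ℚ))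
  rw [← h] at h1 h2
  rw [le_div_iff₀ hy'] at h1
  rw [div_lt_iff₀ hy'] at h2
  exact ⟨by exact_mod_cast h1, by exact_mod_cast h2⟩

/-- The parameters of the main theorem, in terms of natural numbers; here `⌈k / r⌉ = κ + 1` and
`δ = ε + 1`. -/
structure Params (n k r ε κ M a b : ℕ) : Prop where
  r_pos : 0 < r
  r_lt_k : r < k
  ε_pos : 0 < ε
  κ_pos : 0 < κ
  k_add : k + a = (κ + 1) * r
  a_lt : a < r
  n_add : n + b = M * (r + ε)
  b_lt : b < r + ε
  k_le : k + (κ + 1) * ε ≤ n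

namespace Params

variable {n k r ε κ M a b : ℕ}

theorem le_M (h : Params n k r ε κ M a b) : κ + 1 ≤ M := by
  by_contra! hM
  have h1 := Nat.mul_le_mul_right (r + ε) (Nat.le_of_lt_succ hM)
  have h2 := h.n_add
  have h3 := h.k_add
  have h4 := h.k_le
  have h5 := h.a_lt
  rw [mul_add κ] at h1
  rw [add_mul, one_mul] at h3 h4
  omega

/-- With `M = κ + 1`, the assumption `k_le` would force `b ≤ a`. -/
theorem lt_M (h : Params n k r ε κ M a b) (hab : a < b) : κ + 2 ≤ M := by
  refine lt_of_le_of_ne h.le_M ?_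
  rintro rfl
  have h2 := h.n_add
  have h3 := h.k_add
  have h4 := h.k_le
  rw [mul_add] at h2
  omega

/-- The Singleton-type bound in terms of the parameters. -/
theorem add_le (h : Params n k r ε κ M a b) {d : ℕ} (hd : d ∈ achievable n k r (ε + 1)) :
    d + k + κ * ε ≤ n + 1 := by
  obtain ⟨F, _, _, C, hC⟩ := hd
  have h1 := h.k_add
  have h2 := h.a_lt
  rw [add_mul, one_mul] at h1
  exact hC.add_le (by omega)

theorem exists_of_le (h : Params n k r ε κ M a b) (hba : b ≤ a) {D : ℕ}
    (hD : D + k + κ * ε ≤ n + 1) : ∃ d ∈ achievable n k r (ε + 1), D ≤ d := by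
  have := h.a_lt
  have := h.k_add
  have := h.le_M
  have := h.κ_pos
  exact exists_achievable_of_one_overlap h.r_pos h.r_lt_k.le (Nat.succ_le_succ h.ε_pos) h.n_add
    (by omega) (by omega) h.le_M (by omega) hD

/-- Giving up `ε` in the distance replaces `κ` by `κ + 1`, and then `κ + 2` local sets may span `a +
r` edges, more than `b`. -/
theorem exists_of_lt_r (h : Params n k r ε κ M a b) (hab : a < b) (hbr : b < r) {D : ℕ}
    (hD : D + k + (κ + 1) * ε ≤ n + 1) : ∃ d ∈ achievable n k r (ε + 1), D ≤ d := by
  have h1 := h.k_add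
  have h2 := h.lt_M hab
  refine exists_achievable_of_one_overlap h.r_pos h.r_lt_k.le (Nat.succ_le_succ h.ε_pos) h.n_add
    hbr.le ?_ h2 (by omega) hD
  rw [add_mul _ 1, one_mul]
  omega

/-- Uses `M - 1` disjoint local sets and pads the missing `r + ε - b` positions by repetition. -/
theorem exists_of_r_le (h : Params n k r ε κ M a b) (hab : a < b) {D : ℕ}
    (hD : D + k + (κ + 1) * ε + r ≤ n + 1 + b) : ∃ d ∈ achievable n k r (ε + 1), D ≤ d := by
  have h1 := h.k_add
  have h2 := h.lt_M hab
  have h3 := h.n_add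
  have h4 := h.b_lt
  have h5 := h.r_pos
  have h6 := h.κ_pos
  obtain ⟨m, rfl⟩ : ∃ m, M = m + 1 := ⟨M - 1, by omega⟩
  rw [add_mul m, one_mul] at h3
  rw [add_mul κ, one_mul] at hD
  obtain ⟨d, hd, hDd⟩ := exists_achievable_of_one_overlap (n := m * (r + ε)) (k := k) (r := r)
    (δ := ε + 1) (M := m) (b := 0) (K := κ) (D := D) h.r_pos h.r_lt_k.le
    (Nat.succ_le_succ h.ε_pos) rfl (Nat.zero_le _) (by omega) (by omega) (by omega)
    (by rw [Nat.add_sub_cancel]; omega)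
  obtain ⟨d', hd', hdd'⟩ := exists_achievable_of_le_length
    (Nat.mul_pos (by omega) (by omega)) (show m * (r + ε) ≤ n by omega) hd
  exact ⟨d', hd', hDd.trans hdd'⟩

theorem exists_achievable (h : Params n k r ε κ M a b) : ∃ d, d ∈ achievable n k r (ε + 1) := by
  rcases Nat.lt_or_ge a b with hab | hab
  · rcases Nat.lt_or_ge b r with hbr | hbr
    · obtain ⟨d, hd, -⟩ := h.exists_of_lt_r hab hbr (D := 0) (by have := h.k_le; omega)
      exact ⟨d, hd⟩
    · obtain ⟨d, hd, -⟩ := h.exists_of_r_le hab (D := 0) (by have := h.k_le; omega)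
      exact ⟨d, hd⟩
  · obtain ⟨d, hd, -⟩ := h.exists_of_le hab (D := 0) (by
      have := h.k_le
      rw [add_mul] at this
      omega)
    exact ⟨d, hd⟩

theorem isGreatest_dMax (h : Params n k r ε κ M a b) :
    IsGreatest (achievable n k r (ε + 1)) (dMax n k r (ε + 1)) := by
  have hbdd : BddAbove (achievable n k r (ε + 1)) := ⟨n + 1, fun d hd => by
    have := h.add_le hd
    omega⟩
  exact ⟨Nat.sSup_mem h.exists_achievable hbdd, fun d hd => le_csSup hbdd hd⟩

theorem le_dMax (h : Params n k r ε κ M a b) {D : ℕ}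
    (hD : ∃ d ∈ achievable n k r (ε + 1), D ≤ d) : D ≤ dMax n k r (ε + 1) := by
  obtain ⟨d, hd, hDd⟩ := hD
  exact hDd.trans (h.isGreatest_dMax.2 hd)

theorem dMax_eq (h : Params n k r ε κ M a b)
    (hD : ∀ D, D + k + κ * ε ≤ n + 1 → ∃ d ∈ achievable n k r (ε + 1), D ≤ d) :
    dMax n k r (ε + 1) + k + κ * ε = n + 1 := by
  have h1 := h.add_le h.isGreatest_dMax.1
  have h2 := h.k_le
  rw [add_mul, one_mul] at h2
  have h3 := h.le_dMax (hD (n + 1 - k - κ * ε) (by omega))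
  omega

/-- With `h = κ - a` and `m = a - t * h`, any `h` paths have at most `h * t + m = a` edges, and `κ +
1` vertices meeting more than `h` paths span at most `a` edges too. -/
theorem exists_of_paths (h : Params n k r ε κ M a b) (hab : a < b) {t : ℕ} (ht : 0 < t)
    (haκ : a < κ) (h1 : t * (κ - a) ≤ a) (hM : κ * t + (b - a) * (t + 1) ≤ M * t) {D : ℕ}
    (hD : D + k + κ * ε ≤ n + 1) : ∃ d ∈ achievable n k r (ε + 1), D ≤ d := by
  obtain ⟨c, hc⟩ := Nat.exists_eq_add_of_lt haκ
  obtain ⟨m, hm⟩ := Nat.exists_eq_add_of_le h1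
  obtain ⟨l, rfl⟩ := Nat.exists_eq_add_of_lt hab
  rw [show κ - a = c + 1 by omega, mul_comm] at hm
  have h2 := h.a_lt
  have h3 := h.k_add
  have ha : 0 < a := by
    rw [hm]
    positivity
  refine exists_achievable_of_paths (t := t) (m := m) (h := c + 1) (K := κ) (by omega)
    h.r_lt_k.le (Nat.succ_le_succ h.ε_pos) h.n_add ht (by omega) (by omega) ?_ h.le_M hD
  intro p hp
  rw [show a + l + 1 - a = l + 1 by omega] at hM
  refine Nat.lt_of_mul_lt_mul_right (a := t) (lt_of_lt_of_le ?_ hM)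
  have h4 := Nat.div_mul_le_self (p - m) t
  have h5 : p * t ≤ (a + l) * t := Nat.mul_le_mul_right t (by omega)
  rw [add_mul, add_mul, one_mul]
  rw [hc]
  have h6 : (a + c + 1) * t + (l + 1) * (t + 1) = (a + l) * t + ((c + 1) * t + l + 1 + t) := by ring
  rw [h6]
  omega

theorem exists_of_theta (h : Params n k r ε κ M a b) {s t u q x : ℕ} (hs : 0 < s)
    (hsa : s * κ ≤ a) (ht : 2 ≤ t) (hst : s * t ≤ r) (hu : 0 < u) (hκu : κ + 2 ≤ 2 * u)
    (hx : x ≤ t * u)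
    (hM : (b ≤ q * (s * t * u) ∧ q * (t * (u - 1) + 2) ≤ M) ∨
      (b ≤ q * (s * t * u) + x * s ∧
        q * (t * (u - 1) + 2) + (x - x / u + 1 + min (x / u) 1) ≤ M)) {D : ℕ}
    (hD : D + k + κ * ε ≤ n + 1) : ∃ d ∈ achievable n k r (ε + 1), D ≤ d := by
  obtain ⟨v, rfl⟩ : ∃ v, u = v + 1 := ⟨u - 1, by omega⟩
  have h1 := h.k_add
  refine exists_achievable_of_theta (s := s) (t := t) (v := v) h.r_pos h.r_lt_k.le
    (Nat.succ_le_succ h.ε_pos) h.n_add hs ht hst (by omega) (by omega) (fun e i he hi => ?_)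
    h.le_M hD
  rw [Nat.add_sub_cancel] at hM
  rcases hM with ⟨hb, hM⟩ | ⟨hb, hM⟩
  · refine (thetaEnd_lt_mul (by omega) hi (Nat.lt_of_mul_lt_mul_right (a := s) ?_)).trans_le hM
    rw [show q * (t * (v + 1)) * s = q * (s * t * (v + 1)) by ring]
    omega
  · refine (thetaEnd_lt (by omega) hi hx (Nat.lt_of_mul_lt_mul_right (a := s) ?_)).trans_le hM
    rw [show (q * (t * (v + 1)) + x) * s = q * (s * t * (v + 1)) + x * s by ring]
    omega

theorem exists_of_path (h : Params n k r ε 1 M a b) {w z : ℕ} (hw : 0 < w) (hwr : 2 * w ≤ r)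
    (hwa : w ≤ a) (hb : b ≤ z * w) (hz : z + 1 ≤ M) {D : ℕ} (hD : D + k + 1 * ε ≤ n + 1) :
    ∃ d ∈ achievable n k r (ε + 1), D ≤ d := by
  have h1 := h.k_add
  refine exists_achievable_of_path h.r_pos h.r_lt_k.le (Nat.succ_le_succ h.ε_pos) h.n_add hw hwr
    (by omega) (fun p hp => ?_) h.le_M (by rw [Nat.add_sub_cancel]; omega)
  have : p / w < z := (Nat.div_lt_iff_lt_mul hw).2 (hp.trans_le hb)
  omega

end Params

end LRC

/-! ### Translation of the rational floors and ceilings. -/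

theorem mainTheorem9 (n k r δ : ℕ) (K M a b : ℤ)
    (hr : 0 < r) (hrk : r < k) (hδ : 2 ≤ δ)
    (hK : K = ⌈(k : ℚ) / (r : ℚ)⌉)
    (hM : M = ⌈(n : ℚ) / ((r : ℚ) + (δ : ℚ) - 1)⌉)
    (hkn : (k : ℤ) ≤ (n : ℤ) - K * ((δ : ℤ) - 1))
    (ha : a = K * (r : ℤ) - (k : ℤ))
    (hb : b = M * ((r : ℤ) + (δ : ℤ) - 1) - (n : ℤ)) :
    -- the maximum exists and is `LRC.dMax n k r δ`
    IsGreatest (LRC.achievable n k r δ) (LRC.dMax n k r δ) ∧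
    -- (i)
    (b ≤ a →
      (LRC.dMax n k r δ : ℤ) = (n : ℤ) - k + 1 - (K - 1) * ((δ : ℤ) - 1)) ∧
    -- (ii)
    (a < b →
      (b ≤ (r : ℤ) - 1 →
        (n : ℤ) - k + 1 - K * ((δ : ℤ) - 1) ≤ (LRC.dMax n k r δ : ℤ)) ∧
      ((r : ℤ) ≤ b →
        (n : ℤ) - k + 1 - K * ((δ : ℤ) - 1) + (b - r) ≤ (LRC.dMax n k r δ : ℤ))) ∧
    -- (iii)
    (∀ t : ℤ, t = ⌊(a : ℚ) / ((K : ℚ) - 1 - (a : ℚ))⌋ →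
      a < b → ⌊(K : ℚ) / 2⌋ ≤ a → a < K - 1 →
      (K : ℚ) - 1 + ((b : ℚ) - (a : ℚ)) * (1 + 1 / (t : ℚ)) ≤ (M : ℚ) →
      (LRC.dMax n k r δ : ℤ) = (n : ℤ) - k + 1 - (K - 1) * ((δ : ℤ) - 1)) ∧
    -- (iv)
    (∀ s t u x y : ℤ,
      s = ⌊(a : ℚ) / ((K : ℚ) - 1)⌋ →
      t = ⌊((r : ℚ) - 1) / (s : ℚ)⌋ →
      u = ⌈((K : ℚ) + 1) / 2⌉ →
      x = ⌈((b : ℚ) - (⌊(b : ℚ) / ((s : ℚ) * t * u)⌋ : ℚ) * ((s : ℚ) * t * u)) / (s : ℚ)⌉ →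
      y = (if s * t * u ∣ b then 0
            else x - ⌊(x : ℚ) / (u : ℚ)⌋ + 1 + min ⌊(x : ℚ) / (u : ℚ)⌋ 1) →
      a < b → K - 1 ≤ a → 3 ≤ K →
      ⌊(b : ℚ) / ((s : ℚ) * t * u)⌋ * (t * (u - 1) + 2) + y ≤ M →
      (LRC.dMax n k r δ : ℤ) = (n : ℤ) - k + 1 - (K - 1) * ((δ : ℤ) - 1)) ∧
    -- (v)
    (a < b → K - 1 ≤ a → K = 2 →
      ((2 * a ≤ (r : ℤ) - 1 ∧ ⌈(b : ℚ) / (a : ℚ)⌉ + 1 ≤ M) ∨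
        ((r : ℤ) - 1 < 2 * a ∧ 0 < ⌊((r : ℚ) - 1) / 2⌋ ∧
          ⌈(b : ℚ) / (⌊((r : ℚ) - 1) / 2⌋ : ℚ)⌉ + 1 ≤ M)) →
      (LRC.dMax n k r δ : ℤ) = (n : ℤ) - k + 1 - (K - 1) * ((δ : ℤ) - 1)) := by
  obtain ⟨ε, rfl⟩ : ∃ ε, δ = ε + 1 := ⟨δ - 1, by omega⟩
  have hr' : (0 : ℤ) < r := by exact_mod_cast hr
  have hrk' : (r : ℤ) < k := by exact_mod_cast hrk
  have hε : (1 : ℤ) ≤ ε := by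
    have : 1 ≤ ε := by omega
    exact_mod_cast this
  obtain ⟨hK1, hK2⟩ := LRC.ceil_div_spec (x := k) (y := r) hr' (by simpa using hK)
  have hw : (r : ℤ) + ((ε + 1 : ℕ) : ℤ) - 1 = r + ε := by
    push_cast
    ring
  have hδε : ((ε + 1 : ℕ) : ℤ) - 1 = ε := by
    push_cast
    ring
  obtain ⟨hM1, hM2⟩ := LRC.ceil_div_spec (x := n) (y := r + ε) (z := M) (by omega) (by
    rw [hM]
    congr 2
    push_cast
    ring)
  rw [hw] at hb
  rw [hδε] at hkn ⊢
  have hK : 2 ≤ K := by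
    by_contra! h
    have : K * r ≤ 1 * r := mul_le_mul_of_nonneg_right (by omega) hr'.le
    omega
  obtain ⟨κ, rfl⟩ : ∃ κ : ℕ, K = κ + 1 := ⟨(K - 1).toNat, by omega⟩
  have hM0 : 0 ≤ M := by
    by_contra! h
    have : M * (r + ε) < 0 := mul_neg_of_neg_of_pos h (by omega)
    omega
  rw [sub_mul, one_mul] at hK1 hM1
  lift M to ℕ using hM0
  lift a to ℕ using by omega
  lift b to ℕ using by omega
  have h : LRC.Params n k r ε κ M a b :=
    { r_pos := hr
      r_lt_k := hrk
      ε_pos := by omega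
      κ_pos := by omega
      k_add := by
        zify
        omega
      a_lt := by omega
      n_add := by
        zify
        omega
      b_lt := by omega
      k_le := by
        zify
        omega }
  have hmax : (∀ D, D + k + κ * ε ≤ n + 1 → ∃ d ∈ LRC.achievable n k r (ε + 1), D ≤ d) →
      (LRC.dMax n k r (ε + 1) : ℤ) = (n : ℤ) - k + 1 - (((κ : ℤ) + 1) - 1) * (ε : ℤ) := by
    intro hD
    have := h.dMax_eq hD
    zify at this
    rw [add_sub_cancel_right]
    omega
  have hle := h.k_le
  refine ⟨h.isGreatest_dMax, fun hba => hmax fun D => h.exists_of_le (by omega),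
    fun hab => ⟨fun hbr => ?_, fun hrb => ?_⟩, ?_, ?_, ?_⟩
  · have := h.le_dMax (h.exists_of_lt_r (D := n + 1 - k - (κ + 1) * ε) (by omega) (by omega)
      (by omega))
    zify [show (κ + 1) * ε ≤ n + 1 - k by omega, show k ≤ n + 1 by omega] at this
    omega
  · have := h.le_dMax (h.exists_of_r_le (D := n + 1 + b - k - (κ + 1) * ε - r) (by omega)
      (by omega))
    zify [show r ≤ n + 1 + b - k - (κ + 1) * ε by omega,
      show (κ + 1) * ε ≤ n + 1 + b - k by omega, show k ≤ n + 1 + b by omega] at this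
    omega
  · intro t ht hab hKa haK hM
    obtain ⟨ht1, ht2⟩ := LRC.floor_div_spec (x := a) (y := κ - a) (z := t) (by omega) (by
      rw [ht]
      congr 2
      push_cast
      ring)
    obtain ⟨-, hz⟩ := LRC.floor_div_spec (x := κ + 1) (y := 2) (by norm_num)
      (z := ⌊(((κ : ℤ) + 1 : ℤ) : ℚ) / 2⌋) (by norm_num)
    -- The assumption `⌊K/2⌋ ≤ a` says `κ - a ≤ a`.
    have ht0 : 0 < t := by
      by_contra! h
      have : (t + 1) * ((κ : ℤ) - a) ≤ 1 * ((κ : ℤ) - a) :=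
        mul_le_mul_of_nonneg_right (by omega) (by omega)
      omega
    lift t to ℕ using ht0.le
    have hκa : a < κ := by omega
    have hba : a < b := by omega
    refine hmax fun D => h.exists_of_paths hba (t := t) (by omega) hκa ?_ ?_
    · zify [hκa.le]
      exact ht1
    · have htq : (0 : ℚ) < t := by exact_mod_cast ht0
      have h1 := mul_le_mul_of_nonneg_right hM htq.le
      have h2 : ((((κ : ℤ) + 1 : ℤ) : ℚ) - 1 + (((b : ℤ) : ℚ) - ((a : ℤ) : ℚ)) *
          (1 + 1 / ((t : ℤ) : ℚ))) * t = κ * t + (b - a) * (t + 1) := by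
        push_cast
        field_simp
        ring
      have h3 : ((κ : ℚ) * t + (b - a) * (t + 1)) ≤ M * t := by
        rw [← h2]
        exact_mod_cast h1
      zify [hba.le]
      exact_mod_cast h3
  · intro s t u x y hs ht hu hx hy hab hKa hK3 hM
    obtain ⟨hs1, hs2⟩ := LRC.floor_div_spec (x := a) (y := κ) (z := s) (by omega) (by
      rw [hs]
      congr 2
      push_cast
      ring)
    have hs0 : 0 < s := by
      by_contra! h
      have : (s + 1) * (κ : ℤ) ≤ 1 * κ := mul_le_mul_of_nonneg_right (by omega) (by omega)
      omega
    obtain ⟨ht1, ht2⟩ := LRC.floor_div_spec (x := r - 1) (y := s) (z := t) hs0 (by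
      rw [ht]
      congr 2
      push_cast
      ring)
    obtain ⟨hu1, hu2⟩ := LRC.ceil_div_spec (x := κ + 2) (y := 2) (z := u) (by norm_num) (by
      rw [hu]
      congr 2
      push_cast
      ring)
    have hsκ : s * 2 ≤ s * κ := mul_le_mul_of_nonneg_left (by omega) hs0.le
    -- Since `κ ≥ 2`, `2 * s ≤ s * κ ≤ a ≤ r - 1`.
    have ht0 : 2 ≤ t := by
      by_contra! hlt
      have : (t + 1) * s ≤ 2 * s := mul_le_mul_of_nonneg_right (by omega) hs0.le
      have := h.a_lt
      omega
    obtain ⟨q, hq⟩ : ∃ q, q = ⌊((b : ℤ) : ℚ) / ((s : ℚ) * t * u)⌋ := ⟨_, rfl⟩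
    have hstu : 0 < s * t * u := mul_pos (mul_pos hs0 (by omega)) (by omega)
    obtain ⟨hq1, hq2⟩ := LRC.floor_div_spec (x := b) (y := s * t * u) (z := q) hstu (by
      rw [hq]
      push_cast
      rfl)
    rw [← hq] at hx hM
    obtain ⟨hx1, hx2⟩ := LRC.ceil_div_spec (x := b - q * (s * t * u)) (y := s) (z := x) hs0 (by
      rw [hx]
      push_cast
      rfl)
    have hq0 : 0 ≤ q := by
      by_contra! h
      have : (q + 1) * (s * t * u) ≤ 0 := mul_nonpos_of_nonpos_of_nonneg (by omega) hstu.le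
      omega
    have hx0 : 0 ≤ x := by
      by_contra! h
      have : x * s < 0 := mul_neg_of_neg_of_pos h hs0
      omega
    obtain ⟨m, hm⟩ : ∃ m, m = ⌊(x : ℚ) / (u : ℚ)⌋ := ⟨_, rfl⟩
    rw [← hm] at hy
    obtain ⟨hm1, hm2⟩ := LRC.floor_div_spec (x := x) (y := u) (z := m) (by omega) hm
    have hmx : m = x / u := by
      refine ((Int.ediv_eq_iff_of_pos (by omega)).2 ⟨?_, ?_⟩).symm <;> linarith
    -- The remainder of `b` is less than one full theta graph, `s * t * u`.
    have hxtu : x ≤ t * u := by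
      by_contra! h
      have : t * u * s ≤ (x - 1) * s := mul_le_mul_of_nonneg_right (by omega) hs0.le
      linarith
    lift s to ℕ using hs0.le
    lift t to ℕ using by omega
    lift u to ℕ using by omega
    lift q to ℕ using hq0
    lift x to ℕ using hx0
    have hu0 : 0 < u := by omega
    have hxu : x / u ≤ x := Nat.div_le_self x u
    refine hmax fun D => h.exists_of_theta (s := s) (t := t) (u := u) (q := q) (x := x)
      (by omega) (by exact_mod_cast hs1) (by omega) ?_ hu0 (by omega) (by exact_mod_cast hxtu) ?_
    · zify
      linarith
    · by_cases hdvd : (s : ℤ) * t * u ∣ b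
      · left
        rw [if_pos hdvd] at hy
        obtain ⟨c, hc⟩ := hdvd
        have hcq : c ≤ q := by
          by_contra! h
          have : ((q : ℤ) + 1) * (s * t * u) ≤ c * (s * t * u) :=
            mul_le_mul_of_nonneg_right (by omega) hstu.le
          linarith
        have : c * (s * t * u) ≤ q * (s * t * u) := mul_le_mul_of_nonneg_right hcq hstu.le
        zify [Nat.one_le_iff_ne_zero.2 hu0.ne']
        constructor <;> linarith
      · right
        rw [if_neg hdvd, hmx] at hy
        zify [Nat.one_le_iff_ne_zero.2 hu0.ne', hxu]
        constructor <;> linarith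
  · intro hab hKa hK2 hcase
    obtain rfl : κ = 1 := by omega
    -- For `κ = 1` the multiplicity `w` of a path edge needs `w ≤ a` and `2 * w ≤ r`; the
    -- alternatives take `w = a` and `w = ⌊(r - 1)/2⌋`.
    rcases hcase with ⟨har, hM⟩ | ⟨har, hpos, hM⟩
    · obtain ⟨z, hz⟩ : ∃ z, z = ⌈((b : ℤ) : ℚ) / ((a : ℤ) : ℚ)⌉ := ⟨_, rfl⟩
      rw [← hz] at hM
      obtain ⟨hz1, hz2⟩ := LRC.ceil_div_spec (by omega) hz
      have hz0 : 0 ≤ z := by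
        by_contra! h
        have : z * a < 0 := mul_neg_of_neg_of_pos h (by omega)
        omega
      lift z to ℕ using hz0
      exact hmax fun D => h.exists_of_path (w := a) (z := z) (by omega) (by omega) le_rfl
        (by exact_mod_cast hz2) (by omega)
    · obtain ⟨w, hw⟩ : ∃ w, w = ⌊((r : ℚ) - 1) / 2⌋ := ⟨_, rfl⟩
      rw [← hw] at hpos hM
      obtain ⟨hw1, hw2⟩ := LRC.floor_div_spec (x := r - 1) (y := 2) (z := w) (by norm_num) (by
        rw [hw]
        push_cast
        rfl)
      obtain ⟨z, hz⟩ : ∃ z, z = ⌈((b : ℤ) : ℚ) / (w : ℚ)⌉ := ⟨_, rfl⟩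
      rw [← hz] at hM
      obtain ⟨hz1, hz2⟩ := LRC.ceil_div_spec hpos hz
      have hz0 : 0 ≤ z := by
        by_contra! h
        have : z * w < 0 := mul_neg_of_neg_of_pos h hpos
        omega
      lift z to ℕ using hz0
      lift w to ℕ using hpos.le
      exact hmax fun D => h.exists_of_path (w := w) (z := z) (by omega) (by omega) (by omega)
        (by exact_mod_cast hz2) (by omega)
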